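/- All graphs are finite and simple. For a connected graph $G$ let $W(G)=\sum_{\{u,v\}\subseteq V(G)} d_G(u,v)$. A vertex $v$ of a connected graph $G$ is a Šoltés vertex if $G\setminus v$ is connected and $W(G\setminus v)=W(G)$; $G$ is an $\alpha$-Šoltés graph if it is connected and at least $\alpha|V(G)|$ of its vertices are Šoltés vertices. The arc-graph $A(M)$ of a graph $M$ has as vertices the ordered pairs $(u,v)$ of adjacent vertices of $M$; each $(u,v)$ is adjacent to $(v,u)$, and any two distinct arcs $(v,u),(v,w)$ with the same root are adjacent. A $4$-regular Moore graph of girth $12$ is a $4$-regular graph of girth $12$ with $2\sum_{i=0}^{5}3^i=728$ vertices. **Example (a modified quartic $\frac{27}{56}$-Šoltés graph).** A $4$-regular Moore graph $M$ of girth $12$ exists. For every such $M$, the arc-graph $G=A(M)$ is $4$-regular with $2912$ vertices. Let $e=\{(u,w),(w,u)\}$ be any edge of $G$ formed by the two orientations of an edge $uw$ of $M$. Let $Q$ be the graph obtained from $G$ by adding a path with the $111$ vertices $v_{12},v_{13},\dots,v_{122}$ (in this order), joining its end vertex $v_{12}$ to both end vertices of $e$, and adding one more vertex $u_{23}$ joined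 only to $v_{22}$. Then $Q$ has $3024$ vertices, exactly $1458$ of which are Šoltés vertices. In particular, since $\frac{1458}{3024}=\frac{27}{56}$, $Q$ is a $\frac{27}{56}$-Šoltés graph. -/

import Mathlib

namespace Soltes

open SimpleGraph

/-- The total distance (Wiener index): the sum of `d(u, v)` over all unordered pairs of vertices.
It is meant for finite connected graphs. -/
noncomputable def wienerIndex {V : Type*} [Finite V] (G : SimpleGraph V) : ℕ :=
  ∑ᶠ p : Sym2 V, Sym2.lift ⟨fun u v => G.dist u v, fun _ _ => G.dist_comm⟩ p

/-- The graph `G ∖ v`: the vertex `v` and its incident edges are removed. -/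
abbrev deleteVertex {V : Type*} (G : SimpleGraph V) (v : V) : SimpleGraph ↥({v}ᶜ : Set V) :=
  G.induce ({v}ᶜ : Set V)

/-- `v` is a Šoltés vertex of `G`: `G ∖ v` is connected (so that its total distance is finite)
and `W(G ∖ v) = W(G)`. -/
def IsSoltesVertex {V : Type*} [Finite V] (G : SimpleGraph V) (v : V) : Prop :=
  (deleteVertex G v).Connected ∧ wienerIndex (deleteVertex G v) = wienerIndex G

/-- An `α`-Šoltés graph: a connected graph in which at least an `α`-fraction of the vertices
are Šoltés vertices. -/
def IsAlphaSoltes {V : Type*} [Finite V] (α : ℝ) (G : SimpleGraph V) : Prop :=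
  G.Connected ∧ α * (Nat.card V : ℝ) ≤ ({v : V | IsSoltesVertex G v}.ncard : ℝ)

/-- A `d`-regular Moore graph of even girth `2 * k`: its order is the least possible one,
`2 * (1 + (d - 1) + ⋯ + (d - 1) ^ (k - 1))`. -/
structure IsMooreGraph {V : Type*} [Fintype V] (M : SimpleGraph V) [DecidableRel M.Adj]
    (d k : ℕ) : Prop where
  regular : M.IsRegularOfDegree d
  girth_eq : M.girth = 2 * k
  card_eq : Fintype.card V = 2 * ∑ i ∈ Finset.range k, (d - 1) ^ i

/-- The arc-graph: the vertices are the arcs (darts) of `M`, and two distinct arcs are adjacent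
if they have the same root or are the two orientations of one edge. -/
def arcGraph {V : Type*} (M : SimpleGraph V) : SimpleGraph M.Dart where
  Adj a b := b = a.symm ∨ (a ≠ b ∧ a.fst = b.fst)
  symm := ⟨fun a b h => by
    rcases h with h | ⟨h, h'⟩
    · exact Or.inl (by rw [h, Dart.symm_symm])
    · exact Or.inr ⟨h.symm, h'.symm⟩⟩
  loopless := ⟨fun a h => by
    rcases h with h | ⟨h, -⟩
    · exact a.symm_ne h.symm
    · exact h rfl⟩

instance {V : Type*} [DecidableEq V] (M : SimpleGraph V) : DecidableRel (arcGraph M).Adj :=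
  fun a b => inferInstanceAs (Decidable (b = a.symm ∨ (a ≠ b ∧ a.fst = b.fst)))

/-- Adjacency in the graph `attachTree G a b n p` below. -/
def attachTreeAdj {V : Type*} (G : SimpleGraph V) (a b : V) (n p : ℕ) :
    V ⊕ Fin n ⊕ Unit → V ⊕ Fin n ⊕ Unit → Prop
  | .inl x, .inl y => G.Adj x y
  | .inl x, .inr (.inl i) => (x = a ∨ x = b) ∧ i.val = 0
  | .inr (.inl i), .inl x => (x = a ∨ x = b) ∧ i.val = 0
  | .inr (.inl i), .inr (.inl j) => i.val + 1 = j.val ∨ j.val + 1 = i.val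
  | .inr (.inl i), .inr (.inr _) => i.val = p
  | .inr (.inr _), .inr (.inl i) => i.val = p
  | .inl _, .inr (.inr _) => False
  | .inr (.inr _), .inl _ => False
  | .inr (.inr _), .inr (.inr _) => False

/-- Attach to `G` a path with `n` vertices `0, 1, …, n - 1`, whose end vertex `0` is joined to
both `a` and `b`, and one pendent vertex, which is joined to the path vertex `p`. -/
def attachTree {V : Type*} (G : SimpleGraph V) (a b : V) (n p : ℕ) :
    SimpleGraph (V ⊕ Fin n ⊕ Unit) where
  Adj := attachTreeAdj G a b n p
  symm := ⟨fun x y h => by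
    rcases x with x | x | x <;> rcases y with y | y | y <;> simp only [attachTreeAdj] at h ⊢
    · exact h.symm
    · exact h
    · exact h
    · exact h.symm
    · exact h
    · exact h⟩
  loopless := ⟨fun x h => by
    rcases x with x | x | x <;> simp [attachTreeAdj] at h⟩

/-- The graph `Q`: attach to the arc-graph of `M`, at the edge formed by the two orientations
`e` and `e.symm` of an edge of `M`, a path with the `111` vertices `v₁₂, …, v₁₂₂` (here `v_k` has
the index `k - 12`), where `v₁₂` is joined to both ends of the edge, and a pendent vertex at
`v₂₂`. -/
def graphQ {V : Type*} (M : SimpleGraph V) (e : M.Dart) :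
    SimpleGraph (M.Dart ⊕ Fin 111 ⊕ Unit) :=
  attachTree (arcGraph M) e e.symm 111 10

end Soltes

/-! Let `M` be a Moore graph of girth `2 * k + 2` and `vu` an edge. The two trees of depth `k`
hanging at `v` and `u` exhaust the vertices, so `M` is wrapped around a cycle of length `2 * k + 2`,
and every edge points forward or backward. Doubling positions and adding `1` to forward arcs wraps
the arc-graph `G` around a cycle of length `2 * N`, `N = 2 * k + 2`, with the chosen arc alone at
level `0` (`IsCyclicLevel`). This can be done at every arc.

Such a wrapping determines what the deletion of its centre `v` does to distances: for vertices other
than `v` at levels `a ≤ b`, the distance is unchanged when `b - a ≤ N`; otherwise the old geodesic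
passes through `v`, the walk the other way round takes over, and the distance grows by `2 * (b - a -
N)` (`IsCyclicLevel.dist_deleteIncidenceSet`). Only the sizes of the levels enter the sum, so for `d
= 4`, `k = 5` every deletion raises `W(G)` by the same amount: growth `74712 / 2 = 37356` minus lost
distances `29896`, that is `7460`.

The attached tree absorbs this surplus. It has `112` vertices, with distances from the edge `e`
summing to `6228`. It creates no shortcut inside `G`, so deleting a vertex at distance `m` from the
edge additionally removes `112 * m + 6228`, provided the remaining vertices keep their distances to
the tree. The value `7460` is reached exactly at `m = 11`, the largest distance, where nothing
descends through the deleted vertex. For smaller `m` the lengthening of walks can only help, so the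
total still increases strictly. The arcs with `m = 11` form the two middle levels, `3 ^ 6` arcs
each. No tree vertex is a Šoltés vertex: each is a leaf or a cut vertex.

Existence of `M` is a kernel computation on the incidence graph of a generalized hexagon. Two
tabulated automorphisms bring any cycle to one through the vertex `0`, where a table of depths
excludes length below `12`. -/

namespace Soltes

open SimpleGraph

/-! ### Distances in a graph of large girth -/

section Moore

variable {V : Type*} {M : SimpleGraph V}

/-- In a graph of large girth, the neighbour of `x` that is closer to `u` is the only neighbour
of `x` that is not farther from `u` than `x` is. -/
theorem eq_of_adj_of_dist_le {k : ℕ} (hg : 2 * k + 2 ≤ M.girth) {u x y z : V}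
    (hx : M.Reachable u x) (hk : M.dist u x ≤ k)
    (hxy : M.Adj x y) (hxz : M.Adj x z) (hy : M.dist u y < M.dist u x)
    (hz : M.dist u z ≤ M.dist u x) : y = z := by
  classical
  by_contra hne
  have key : ∀ w, M.Adj x w → M.dist u w ≤ M.dist u x →
      ∃ p : M.Walk x u, p.IsPath ∧ p.snd = w ∧ p.length = M.dist u w + 1 := by
    intro w hw hwd
    obtain ⟨p, hp, hpl⟩ := (hx.trans hw.reachable).symm.exists_path_of_dist
    have hxp : x ∉ p.support := by
      intro hmem
      have h1 := M.dist_le (p.dropUntil x hmem)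
      have h2 := congrArg Walk.length (p.take_spec hmem)
      have h3 : 0 < (p.takeUntil x hmem).length := by
        rcases Nat.eq_zero_or_pos (p.takeUntil x hmem).length with h | h
        · exact absurd (Walk.eq_of_length_eq_zero h) hw.ne'
        · exact h
      rw [Walk.length_append] at h2
      rw [dist_comm] at h1
      rw [dist_comm] at hpl
      omega
    refine ⟨Walk.cons hw p, (Walk.cons_isPath_iff _ _).2 ⟨hp, hxp⟩, by simp, ?_⟩
    rw [dist_comm] at hpl
    simp only [Walk.length_cons, hpl]
  obtain ⟨p, hp, hpy, hpl⟩ := key y hxy hy.le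
  obtain ⟨q, hq, hqz, hql⟩ := key z hxz hz
  have hpq : p ≠ q := by
    rintro rfl
    exact hne (hpy.symm.trans hqz)
  -- The path through `y` has length at most `k`, by strictness of `hy`, and the one through `z` at
  -- most `k + 1`; the cycle in their union is shorter than the girth.
  obtain ⟨w, -, -, c, hc, hcl⟩ := hp.exists_isCycle_length_le_add_of_ne hq hpq
  have := girth_le_length hc
  omega

/-- The vertices at distance `i` from `v` whose distance to `u` is `i + 1`: when `u` and `v` are
adjacent, these are the vertices at depth `i` on the side of `v` of the edge `uv`. -/
noncomputable def side [Fintype V] (M : SimpleGraph V) (v u : V) (i : ℕ) : Finset V :=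
  by classical exact {x | M.Reachable v x ∧ M.dist v x = i ∧ M.dist u x = i + 1}

theorem mem_side [Fintype V] {v u x : V} {i : ℕ} :
    x ∈ side M v u i ↔ M.Reachable v x ∧ M.dist v x = i ∧ M.dist u x = i + 1 := by
  simp [side]

theorem exists_adj_dist_lt {u x : V} (h : M.Reachable u x) (hpos : 0 < M.dist u x) :
    ∃ y, M.Adj x y ∧ M.dist u y + 1 = M.dist u x := by
  obtain ⟨p, hp⟩ := h.symm.exists_walk_length_eq_dist
  cases p with
  | nil => simp at hpos
  | @cons _ y _ hxy q =>
    refine ⟨y, hxy, ?_⟩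
    have h1 := M.dist_le q
    have h2 := h.dist_triangle_left y
    rw [dist_comm] at h1
    rw [Walk.length_cons, dist_comm] at hp
    have h3 := (h.trans hxy.reachable).dist_triangle_left x
    rw [dist_eq_one_iff_adj.2 hxy.symm] at h3
    omega

theorem dist_le_dist_add_one {u x y : V} (h : M.Reachable u x) (hxy : M.Adj x y) :
    M.dist u y ≤ M.dist u x + 1 := by
  have h3 := h.dist_triangle_left y
  rwa [dist_eq_one_iff_adj.2 hxy] at h3

end Moore

/-! ### The two trees at the ends of an edge -/

section MooreSides

variable {V : Type*} [Fintype V] {M : SimpleGraph V}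

/-- Uniqueness of the closer neighbour is applied from `u`, where `x` has distance `i + 1`; this is
why `i < k` is strict. A neighbour not farther from `u` is then the parent of `x`, or `u` itself at
the root. -/
theorem adj_side_eq_or_mem_side_succ {k : ℕ} (hg : 2 * k + 2 ≤ M.girth) {v u x y : V} {i : ℕ}
    (hvu : M.Adj v u) (hi : i < k) (hx : x ∈ side M v u i) (hxy : M.Adj x y) :
    (i = 0 ∧ y = u) ∨ (0 < i ∧ y ∈ side M v u (i - 1)) ∨ y ∈ side M v u (i + 1) := by
  rw [mem_side] at hx
  obtain ⟨hr, hxv, hxu⟩ := hx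
  have hru : M.Reachable u x := hvu.symm.reachable.trans hr
  have hry : M.Reachable v y := hr.trans hxy.reachable
  have h1 := dist_le_dist_add_one hru hxy
  have h2 := dist_le_dist_add_one hr hxy
  have h3 := dist_le_dist_add_one hry.symm hvu
  rw [dist_comm, M.dist_comm (u := y)] at h3
  rcases lt_or_ge (M.dist u x) (M.dist u y) with h | h
  · exact Or.inr (Or.inr (mem_side.2 ⟨hry, by omega, by omega⟩))
  · rcases Nat.eq_zero_or_pos i with rfl | hpos
    · have hxv' : v = x := (hr.dist_eq_zero_iff).1 hxv
      subst hxv'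
      refine Or.inl ⟨rfl, ?_⟩
      exact (eq_of_adj_of_dist_le hg hru (by omega) hvu hxy (by rw [dist_self, hxu]; omega)
        h).symm
    · obtain ⟨z, hxz, hz⟩ := exists_adj_dist_lt hr (by omega)
      have hrz : M.Reachable v z := hr.trans hxz.reachable
      have h4 := dist_le_dist_add_one hrz.symm hvu
      have h5 := dist_le_dist_add_one (hru.trans hxz.reachable) hxz.symm
      rw [dist_comm, M.dist_comm (u := z)] at h4
      have : z = y := eq_of_adj_of_dist_le hg hru (by omega) hxz hxy (by omega) h
      subst this
      exact Or.inr (Or.inl ⟨hpos, mem_side.2 ⟨hrz, by omega, by omega⟩⟩)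

variable [DecidableRel M.Adj]

/-- On its side of the edge `vu`, a vertex has exactly one neighbour that is closer to `v`. -/
theorem card_filter_side_pred {k : ℕ} (hg : 2 * k + 2 ≤ M.girth) {v u x : V} {i : ℕ}
    (hvu : M.Adj v u) (hi : i < k) (hx : x ∈ side M v u (i + 1)) :
    ((side M v u i).filter fun y => M.Adj x y).card = 1 := by
  rw [mem_side] at hx
  obtain ⟨hr, hxv, hxu⟩ := hx
  obtain ⟨z, hxz, hz⟩ := exists_adj_dist_lt hr (by omega)
  have hrz : M.Reachable v z := hr.trans hxz.reachable
  have h4 := dist_le_dist_add_one hrz.symm hvu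
  have h5 := dist_le_dist_add_one ((hvu.symm.reachable.trans hr).trans hxz.reachable) hxz.symm
  rw [dist_comm, M.dist_comm (u := z)] at h4
  rw [Finset.card_eq_one]
  refine ⟨z, Finset.ext fun y => ?_⟩
  rw [Finset.mem_filter, Finset.mem_singleton, mem_side]
  constructor
  · rintro ⟨⟨-, hy, -⟩, hxy⟩
    exact (eq_of_adj_of_dist_le hg hr (by omega) hxz hxy (by omega) (by omega)).symm
  · rintro rfl
    exact ⟨⟨hrz, by omega, by omega⟩, hxz⟩

theorem card_filter_side_succ [DecidableEq V] {d k : ℕ} (hreg : M.IsRegularOfDegree d)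
    (hg : 2 * k + 2 ≤ M.girth) {v u x : V} {i : ℕ} (hvu : M.Adj v u) (hi : i < k)
    (hx : x ∈ side M v u i) :
    ((side M v u (i + 1)).filter fun y => M.Adj x y).card = d - 1 := by
  have hdisj : ∀ y ∈ side M v u (i + 1), ¬ (y = u) ∧ y ∉ side M v u (i - 1) := by
    intro y hy
    rw [mem_side] at hy
    refine ⟨?_, fun h => ?_⟩
    · rintro rfl
      have := hy.2.2
      rw [dist_self] at this
      omega
    · rw [mem_side] at h
      omega
  have hsub : (side M v u (i + 1)).filter (fun y => M.Adj x y) ⊆ M.neighborFinset x := by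
    intro y hy
    rw [mem_neighborFinset]
    exact (Finset.mem_filter.1 hy).2
  have key : (M.neighborFinset x \ (side M v u (i + 1)).filter fun y => M.Adj x y).card = 1 := by
    rcases Nat.eq_zero_or_pos i with rfl | hpos
    · rw [Finset.card_eq_one]
      refine ⟨u, Finset.ext fun y => ?_⟩
      rw [Finset.mem_sdiff, mem_neighborFinset, Finset.mem_filter, Finset.mem_singleton]
      constructor
      · rintro ⟨hxy, h⟩
        rcases adj_side_eq_or_mem_side_succ hg hvu hi hx hxy with h' | h' | h'
        · exact h'.2
        · exact absurd h'.1 (by simp)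
        · exact absurd ⟨h', hxy⟩ h
      · rintro rfl
        rw [mem_side] at hx
        obtain rfl : v = x := (hx.1.dist_eq_zero_iff).1 hx.2.1
        exact ⟨hvu, fun h => (hdisj _ h.1).1 rfl⟩
    · obtain ⟨j, rfl⟩ := Nat.exists_eq_succ_of_ne_zero hpos.ne'
      refine Eq.trans (congrArg _ (Finset.ext fun y => ?_))
        (card_filter_side_pred hg hvu (by omega) hx)
      rw [Finset.mem_sdiff, mem_neighborFinset, Finset.mem_filter, Finset.mem_filter]
      constructor
      · rintro ⟨hxy, h⟩
        rcases adj_side_eq_or_mem_side_succ hg hvu hi hx hxy with h' | h' | h'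
        · exact absurd h'.1 (by simp)
        · exact ⟨h'.2, hxy⟩
        · exact absurd ⟨h', hxy⟩ h
      · rintro ⟨h, hxy⟩
        exact ⟨hxy, fun h' => (hdisj _ h'.1).2 h⟩
  rw [Finset.card_sdiff_of_subset hsub, card_neighborFinset_eq_degree, hreg x] at key
  omega

/-- Double counting of the edges between consecutive depths: `d - 1` downwards from each vertex, one
upwards. -/
theorem card_side [DecidableEq V] {d k : ℕ} (hreg : M.IsRegularOfDegree d)
    (hg : 2 * k + 2 ≤ M.girth) {v u : V} (hvu : M.Adj v u) {i : ℕ} (hi : i ≤ k) :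
    (side M v u i).card = (d - 1) ^ i := by
  induction i with
  | zero =>
    rw [pow_zero, Finset.card_eq_one]
    refine ⟨v, Finset.ext fun y => ?_⟩
    rw [mem_side, Finset.mem_singleton]
    constructor
    · rintro ⟨hr, h, -⟩
      exact ((hr.dist_eq_zero_iff).1 h).symm
    · rintro rfl
      exact ⟨Reachable.refl _, dist_self, dist_eq_one_iff_adj.2 hvu.symm⟩
  | succ i ih =>
    have h := Finset.card_mul_eq_card_mul (fun x y => M.Adj x y) (s := side M v u i)
      (t := side M v u (i + 1)) (m := d - 1) (n := 1)
      (fun x hx => card_filter_side_succ hreg hg hvu (by omega) hx)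
      (fun y hy => by
        rw [← card_filter_side_pred hg hvu (by omega) hy]
        congr 1
        ext x
        rw [Finset.mem_bipartiteBelow, Finset.mem_filter, M.adj_comm])
    rw [mul_one, ih (by omega), ← pow_succ] at h
    exact h.symm

/-- Every vertex of a Moore graph of even girth lies in one of the two trees that hang at the
ends of an edge. -/
theorem IsMooreGraph.exists_mem_side [DecidableEq V] {d k : ℕ} (hM : IsMooreGraph M d (k + 1)) {v u : V}
    (hvu : M.Adj v u) (x : V) : ∃ i ≤ k, x ∈ side M v u i ∨ x ∈ side M u v i := by
  have hg : 2 * k + 2 ≤ M.girth := hM.girth_eq.ge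
  have hdisj : ∀ {a b : V} {i j : ℕ}, i ≠ j → Disjoint (side M a b i) (side M a b j) := by
    intro a b i j hij
    rw [Finset.disjoint_left]
    intro y hy hy'
    rw [mem_side] at hy hy'
    omega
  have hcard : ∀ {a b : V}, M.Adj a b → ((Finset.range (k + 1)).biUnion (side M a b)).card =
      ∑ i ∈ Finset.range (k + 1), (d - 1) ^ i := by
    intro a b hab
    rw [Finset.card_biUnion fun i _ j _ hij => hdisj hij]
    exact Finset.sum_congr rfl fun i hi =>
      card_side hM.regular hg hab (Nat.lt_succ_iff.1 (Finset.mem_range.1 hi))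
  have hd : Disjoint ((Finset.range (k + 1)).biUnion (side M v u))
      ((Finset.range (k + 1)).biUnion (side M u v)) := by
    rw [Finset.disjoint_left]
    intro y hy hy'
    simp only [Finset.mem_biUnion, mem_side] at hy hy'
    obtain ⟨i, -, hy⟩ := hy
    obtain ⟨j, -, hy'⟩ := hy'
    omega
  -- The two disjoint trees already account for the whole order prescribed by the Moore condition.
  have huniv : (Finset.range (k + 1)).biUnion (side M v u) ∪
      (Finset.range (k + 1)).biUnion (side M u v) = Finset.univ := by
    rw [← Finset.card_eq_iff_eq_univ, Finset.card_union_of_disjoint hd, hcard hvu,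
      hcard hvu.symm, hM.card_eq, two_mul]
  have hx := Finset.mem_univ x
  rw [← huniv] at hx
  simp only [Finset.mem_union, Finset.mem_biUnion, Finset.mem_range] at hx
  rcases hx with ⟨i, hi, hx⟩ | ⟨i, hi, hx⟩
  · exact ⟨i, by omega, Or.inl hx⟩
  · exact ⟨i, by omega, Or.inr hx⟩

theorem IsMooreGraph.reachable [DecidableEq V] {d k : ℕ} (hM : IsMooreGraph M d (k + 1)) {v u : V}
    (hvu : M.Adj v u) (x : V) : M.Reachable v x := by
  obtain ⟨i, -, h | h⟩ := hM.exists_mem_side hvu x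
  · exact (mem_side.1 h).1
  · exact hvu.reachable.trans (mem_side.1 h).1

end MooreSides

/-! ### Wrapping a Moore graph around a cycle -/

section MoorePosition

variable {V : Type*} [Fintype V] {M : SimpleGraph V}

/-- The position of `x` on a cycle of length `2 * k + 2` through the adjacent vertices `v` and `u`
of a Moore graph of girth `2 * k + 2`; the positions of `v` and `u` are `0` and `2 * k + 1`. -/
noncomputable def position (M : SimpleGraph V) (k : ℕ) (v u x : V) : ℕ :=
  if M.dist v x < M.dist u x then M.dist v x else 2 * k + 1 - M.dist u x

theorem position_of_mem_side {k i : ℕ} {v u x : V} (hx : x ∈ side M v u i) :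
    position M k v u x = i := by
  rw [mem_side] at hx
  rw [position, if_pos (by omega)]
  exact hx.2.1

theorem position_of_mem_side_swap {k i : ℕ} {v u x : V} (hx : x ∈ side M u v i) :
    position M k v u x = 2 * k + 1 - i := by
  rw [mem_side] at hx
  rw [position, if_neg (by omega), hx.2.1]

variable {d k : ℕ} {v u : V}

theorem mem_side_zero (hvu : M.Adj v u) {x : V} : x ∈ side M v u 0 ↔ x = v := by
  rw [mem_side]
  constructor
  · rintro ⟨hr, h, -⟩
    exact ((hr.dist_eq_zero_iff).1 h).symm
  · rintro rfl
    exact ⟨Reachable.refl _, dist_self, dist_eq_one_iff_adj.2 hvu.symm⟩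

variable [DecidableEq V] [DecidableRel M.Adj]

theorem IsMooreGraph.position_swap (hM : IsMooreGraph M d (k + 1)) (hvu : M.Adj v u) (x : V) :
    position M k u v x = 2 * k + 1 - position M k v u x := by
  obtain ⟨i, hi, h | h⟩ := hM.exists_mem_side hvu x
  · rw [position_of_mem_side h, position_of_mem_side_swap h]
  · rw [position_of_mem_side h, position_of_mem_side_swap h]
    omega

theorem IsMooreGraph.position_le (hM : IsMooreGraph M d (k + 1)) (hvu : M.Adj v u) (x : V) :
    position M k v u x ≤ 2 * k + 1 := by
  obtain ⟨i, hi, h | h⟩ := hM.exists_mem_side hvu x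
  · rw [position_of_mem_side h]
    omega
  · rw [position_of_mem_side_swap h]
    omega

theorem IsMooreGraph.mem_side_iff (hM : IsMooreGraph M d (k + 1)) (hvu : M.Adj v u) {i : ℕ}
    (hi : i ≤ k) {x : V} : x ∈ side M v u i ↔ position M k v u x = i := by
  refine ⟨position_of_mem_side, fun h => ?_⟩
  obtain ⟨j, hj, h' | h'⟩ := hM.exists_mem_side hvu x
  · rw [position_of_mem_side h'] at h
    rwa [← h]
  · rw [position_of_mem_side_swap h'] at h
    omega

theorem IsMooreGraph.position_eq_zero (hM : IsMooreGraph M d (k + 1)) (hvu : M.Adj v u) {x : V} :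
    position M k v u x = 0 ↔ x = v := by
  rw [← hM.mem_side_iff hvu (Nat.zero_le k), mem_side_zero hvu]

theorem IsMooreGraph.position_eq_last (hM : IsMooreGraph M d (k + 1)) (hvu : M.Adj v u) {x : V} :
    position M k v u x = 2 * k + 1 ↔ x = u := by
  rw [← hM.position_eq_zero hvu.symm, hM.position_swap hvu]
  have := hM.position_le hvu x
  omega

/-- Below the leaves this is the tree structure. At a leaf, any edge other than the one to its
parent must cross to a leaf of the other tree. -/
theorem IsMooreGraph.position_adj_of_le (hM : IsMooreGraph M d (k + 1)) (hvu : M.Adj v u)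
    {x y : V} (hx : position M k v u x ≤ k) (hxy : M.Adj x y) :
    position M k v u y = position M k v u x + 1 ∨
      position M k v u x = position M k v u y + 1 ∨
      position M k v u x = 0 ∧ position M k v u y = 2 * k + 1 := by
  have hg : 2 * k + 2 ≤ M.girth := hM.girth_eq.ge
  have hxs := (hM.mem_side_iff hvu hx).2 rfl
  generalize hi : position M k v u x = i at *
  rcases hx.lt_or_eq with hik | rfl
  · rcases adj_side_eq_or_mem_side_succ hg hvu hik hxs hxy with h | h | h
    · exact Or.inr (Or.inr ⟨h.1, (hM.position_eq_last hvu).2 h.2⟩)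
    · rw [position_of_mem_side h.2]
      omega
    · exact Or.inl (position_of_mem_side h)
  · rw [mem_side] at hxs
    obtain ⟨hr, h1, h2⟩ := hxs
    have h3 := dist_le_dist_add_one hr hxy
    obtain ⟨j, hj, h | h⟩ := hM.exists_mem_side hvu y
    · have h4 := mem_side.1 h
      rcases Nat.eq_zero_or_pos i with rfl | hpos
      · obtain rfl : j = 0 := by omega
        rw [mem_side_zero hvu] at h
        have := (hr.dist_eq_zero_iff).1 h1
        exact absurd (h.trans this) hxy.ne'
      · obtain ⟨z, hxz, hz⟩ := exists_adj_dist_lt hr (by omega)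
        have : z = y := eq_of_adj_of_dist_le hg hr h1.le hxz hxy (by omega) (by omega)
        subst this
        rw [position_of_mem_side h]
        omega
    · have h4 := mem_side.1 h
      rw [position_of_mem_side_swap h]
      -- A neighbour in the other tree that is not a leaf would be no farther from `v` than `x` is,
      -- hence would be the parent of `x`; its distance to `u` is too small for that.
      have : j = i := by
        by_contra hne
        rcases Nat.eq_zero_or_pos i with rfl | hpos
        · omega
        · obtain ⟨z, hxz, hz⟩ := exists_adj_dist_lt hr (by omega)
          have hrz : M.Reachable v z := hr.trans hxz.reachable
          have h5 := dist_le_dist_add_one hrz.symm hvu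
          rw [dist_comm, M.dist_comm (u := z)] at h5
          have : z = y := eq_of_adj_of_dist_le hg hr h1.le hxz hxy (by omega) (by omega)
          subst this
          have h6 := dist_le_dist_add_one (hvu.symm.reachable.trans hrz) hxz.symm
          omega
      omega

theorem IsMooreGraph.position_adj (hM : IsMooreGraph M d (k + 1)) (hvu : M.Adj v u)
    {x y : V} (hxy : M.Adj x y) :
    position M k v u y = position M k v u x + 1 ∨
      position M k v u x = position M k v u y + 1 ∨
      position M k v u x = 0 ∧ position M k v u y = 2 * k + 1 ∨
      position M k v u y = 0 ∧ position M k v u x = 2 * k + 1 := by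
  have hx := hM.position_le hvu x
  have hy := hM.position_le hvu y
  rcases le_or_gt (position M k v u x) k with h | h
  · have := hM.position_adj_of_le hvu h hxy
    omega
  · have := hM.position_adj_of_le hvu.symm (x := x) (by rw [hM.position_swap hvu]; omega) hxy
    rw [hM.position_swap hvu, hM.position_swap hvu] at this
    omega

/-- The edge from `x` to `y` leads to the next position. -/
def IsForward (M : SimpleGraph V) (k : ℕ) (v u x y : V) : Prop :=
  position M k v u y = position M k v u x + 1 ∨
    position M k v u x = 2 * k + 1 ∧ position M k v u y = 0

noncomputable instance (v u x y : V) : Decidable (IsForward M k v u x y) :=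
  Classical.dec _

theorem IsMooreGraph.card_not_isForward (hM : IsMooreGraph M d (k + 1)) (hk : 0 < k)
    (hvu : M.Adj v u) {x : V} (hx : position M k v u x ≤ k) :
    ((M.neighborFinset x).filter fun y => ¬ IsForward M k v u x y).card = 1 := by
  have hg : 2 * k + 2 ≤ M.girth := hM.girth_eq.ge
  rcases Nat.eq_zero_or_pos (position M k v u x) with h0 | hpos
  · rw [Finset.card_eq_one]
    refine ⟨u, Finset.ext fun y => ?_⟩
    rw [Finset.mem_filter, mem_neighborFinset, Finset.mem_singleton,
      ← hM.position_eq_last hvu (x := y), IsForward]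
    constructor
    · rintro ⟨hxy, h⟩
      have := hM.position_adj hvu hxy
      omega
    · intro h
      refine ⟨?_, by omega⟩
      rw [(hM.position_eq_last hvu).1 h, (hM.position_eq_zero hvu).1 h0]
      exact hvu
  · obtain ⟨i, hi⟩ := Nat.exists_eq_succ_of_ne_zero hpos.ne'
    rw [hi] at hx
    refine Eq.trans (congrArg _ (Finset.ext fun y => ?_)) (card_filter_side_pred hg hvu
      (Nat.lt_of_succ_le hx) ((hM.mem_side_iff hvu hx).2 hi))
    rw [Finset.mem_filter, mem_neighborFinset, Finset.mem_filter, hM.mem_side_iff hvu (by omega),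
      and_comm, and_congr_left_iff, IsForward]
    intro hxy
    have := hM.position_adj hvu hxy
    omega

theorem IsMooreGraph.card_isForward_of_le (hM : IsMooreGraph M d (k + 1)) (hk : 0 < k)
    (hvu : M.Adj v u) {x : V} (hx : position M k v u x ≤ k) :
    ((M.neighborFinset x).filter fun y => IsForward M k v u x y).card = d - 1 := by
  have h := Finset.card_filter_add_card_filter_not (s := M.neighborFinset x)
    (fun y => IsForward M k v u x y)
  rw [hM.card_not_isForward hk hvu hx, card_neighborFinset_eq_degree, hM.regular x] at h
  omega

/-- Exchanging the ends of the base edge reflects the cycle of positions. For `k = 0` this cycle has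
length two and an edge is forward in both senses, whence `0 < k`. -/
theorem IsMooreGraph.isForward_swap (hM : IsMooreGraph M d (k + 1)) (hk : 0 < k)
    (hvu : M.Adj v u) {x y : V} (hxy : M.Adj x y) :
    IsForward M k u v x y ↔ ¬ IsForward M k v u x y := by
  have h1 := hM.position_adj hvu hxy
  have hx := hM.position_le hvu x
  have hy := hM.position_le hvu y
  rw [IsForward, IsForward, hM.position_swap hvu, hM.position_swap hvu]
  omega

/-- The first tree branches forward, the second merges; reflection turns forward edges here into
backward edges in the first half. -/
theorem IsMooreGraph.card_isForward_of_lt (hM : IsMooreGraph M d (k + 1)) (hk : 0 < k)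
    (hvu : M.Adj v u) {x : V} (hx : k < position M k v u x) :
    ((M.neighborFinset x).filter fun y => IsForward M k v u x y).card = 1 := by
  have hx' := hM.position_le hvu x
  rw [← hM.card_not_isForward hk hvu.symm (x := x) (by rw [hM.position_swap hvu]; omega)]
  congr 1
  refine Finset.filter_congr fun y hy => ?_
  rw [mem_neighborFinset] at hy
  rw [hM.isForward_swap hk hvu hy, not_not]

theorem IsMooreGraph.card_not_isForward_of_lt (hM : IsMooreGraph M d (k + 1)) (hk : 0 < k)
    (hvu : M.Adj v u) {x : V} (hx : k < position M k v u x) :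
    ((M.neighborFinset x).filter fun y => ¬ IsForward M k v u x y).card = d - 1 := by
  have h := Finset.card_filter_add_card_filter_not (s := M.neighborFinset x)
    (fun y => IsForward M k v u x y)
  rw [hM.card_isForward_of_lt hk hvu hx, card_neighborFinset_eq_degree, hM.regular x] at h
  omega

theorem IsMooreGraph.card_position_eq (hM : IsMooreGraph M d (k + 1)) (hvu : M.Adj v u) {i : ℕ}
    (hi : i ≤ k) : (Finset.univ.filter fun x => position M k v u x = i).card = (d - 1) ^ i := by
  rw [← card_side hM.regular hM.girth_eq.ge hvu hi]
  congr 1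
  ext x
  rw [Finset.mem_filter, hM.mem_side_iff hvu hi, and_iff_right (Finset.mem_univ x)]

theorem IsMooreGraph.card_position_eq_sub (hM : IsMooreGraph M d (k + 1)) (hvu : M.Adj v u)
    {i : ℕ} (hi : i ≤ k) :
    (Finset.univ.filter fun x => position M k v u x = 2 * k + 1 - i).card = (d - 1) ^ i := by
  rw [← hM.card_position_eq hvu.symm hi]
  congr 1
  refine Finset.filter_congr fun x _ => ?_
  have := hM.position_le hvu x
  rw [hM.position_swap hvu]
  omega

end MoorePosition

/-! ### Deleting a vertex from a graph wrapped around a cycle -/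

section CyclicLevel

variable {V : Type*}

/-- `g` wraps the graph `G` around a cycle of length `2 * N`: the vertex `v` is the only one at the
level `0`, adjacent vertices are at equal or cyclically consecutive levels, every vertex has
neighbours at the next and at the previous level, and neighbours of `v` at the same level are
adjacent. -/
structure IsCyclicLevel (G : SimpleGraph V) (N : ℕ) (v : V) (g : V → ℕ) : Prop where
  lt (w : V) : g w < 2 * N
  eq_zero (w : V) : g w = 0 ↔ w = v
  adj (w z : V) : G.Adj w z → g z = g w ∨ g z = g w + 1 ∨ g w = g z + 1 ∨
    (g w = 0 ∧ g z + 1 = 2 * N) ∨ (g z = 0 ∧ g w + 1 = 2 * N)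
  exists_down (w : V) : 0 < g w → ∃ z, G.Adj w z ∧ g z + 1 = g w
  exists_up (w : V) : 0 < g w → ∃ z, G.Adj w z ∧ (g z = g w + 1 ∨ (g w + 1 = 2 * N ∧ z = v))
  clique (w z : V) : G.Adj v w → G.Adj v z → g w = g z → w ≠ z → G.Adj w z

variable {G K : SimpleGraph V} {N : ℕ} {v : V} {g : V → ℕ}

namespace IsCyclicLevel

/-- The invariant `P` travels along the descent, so one argument yields walks in `G` and walks in `K
= G` minus a vertex. Stopping at level `1` leaves out the last edge into `v`. -/
theorem exists_walk_down_one (hg : IsCyclicLevel G N v g) (P : V → Prop)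
    (hP : ∀ w z, P w → 1 < g w → G.Adj w z → g z + 1 = g w → P z ∧ K.Adj w z) (w : V)
    (hw : P w) (hpos : 0 < g w) :
    ∃ z, P z ∧ g z = 1 ∧ ∃ p : K.Walk w z, p.length + 1 = g w := by
  induction h : g w using Nat.strong_induction_on generalizing w with
  | _ n ih =>
    rcases Nat.lt_or_ge 1 (g w) with h1 | h1
    · obtain ⟨w', hadj, hw'⟩ := hg.exists_down w hpos
      obtain ⟨hPw', hK⟩ := hP w w' hw h1 hadj hw'
      obtain ⟨z, hz, hgz, p, hp⟩ := ih (g w') (by omega) w' hPw' (by omega) rfl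
      exact ⟨z, hz, hgz, Walk.cons hK p, by rw [Walk.length_cons]; omega⟩
    · exact ⟨w, hw, by omega, Walk.nil, by rw [Walk.length_nil]; omega⟩

theorem adj_of_eq_one (hg : IsCyclicLevel G N v g) {z : V} (hz : g z = 1) : G.Adj z v := by
  obtain ⟨z', hadj, hz'⟩ := hg.exists_down z (by omega)
  rwa [← (hg.eq_zero z').1 (by omega)]

theorem exists_walk_down (hg : IsCyclicLevel G N v g) (P : V → Prop)
    (hP : ∀ w z, P w → 0 < g w → G.Adj w z → g z + 1 = g w → P z ∧ K.Adj w z) (w : V)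
    (hw : P w) : ∃ p : K.Walk w v, p.length = g w := by
  rcases Nat.eq_zero_or_pos (g w) with h0 | hpos
  · obtain rfl := (hg.eq_zero w).1 h0
    exact ⟨Walk.nil, by rw [h0, Walk.length_nil]⟩
  · obtain ⟨z, hz, hgz, p, hp⟩ := hg.exists_walk_down_one P
      (fun w z hw h1 => hP w z hw (by omega)) w hw hpos
    have h0 := (hg.eq_zero v).2 rfl
    refine ⟨p.concat (hP z v hz (by omega) (hg.adj_of_eq_one hgz) (by omega)).2, ?_⟩
    rwa [Walk.length_concat]

theorem exists_walk_up_one (hg : IsCyclicLevel G N v g) (P : V → Prop)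
    (hP : ∀ w z, P w → 0 < g w → G.Adj w z → g z = g w + 1 → P z ∧ K.Adj w z) (w : V)
    (hw : P w) (hpos : 0 < g w) :
    ∃ z, P z ∧ g z + 1 = 2 * N ∧ ∃ p : K.Walk w z, p.length + g w + 1 = 2 * N := by
  induction h : 2 * N - g w using Nat.strong_induction_on generalizing w with
  | _ n ih =>
    have hlt := hg.lt w
    obtain ⟨w', hadj, hw' | hw'⟩ := hg.exists_up w hpos
    · obtain ⟨hPw', hK⟩ := hP w w' hw hpos hadj hw'
      obtain ⟨z, hz, hgz, p, hp⟩ := ih (2 * N - g w') (by omega) w' hPw' (by omega) rfl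
      exact ⟨z, hz, hgz, Walk.cons hK p, by rw [Walk.length_cons]; omega⟩
    · exact ⟨w, hw, hw'.1, Walk.nil, by rw [Walk.length_nil]; omega⟩

theorem adj_of_eq_last (hg : IsCyclicLevel G N v g) {z : V} (hz : g z + 1 = 2 * N)
    (hpos : 0 < g z) : G.Adj z v := by
  obtain ⟨z', hadj, hz' | hz'⟩ := hg.exists_up z hpos
  · have := hg.lt z'
    omega
  · rwa [← hz'.2]

theorem exists_walk_up (hg : IsCyclicLevel G N v g) (P : V → Prop)
    (hP : ∀ w z, P w → 0 < g w → G.Adj w z → (g z = g w + 1 ∨ z = v) → (z = v ∨ P z) ∧ K.Adj w z)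
    (w : V) (hw : P w) (hpos : 0 < g w) : ∃ p : K.Walk w v, p.length + g w = 2 * N := by
  have h0 := (hg.eq_zero v).2 rfl
  obtain ⟨z, hz, hgz, p, hp⟩ := hg.exists_walk_up_one P
    (fun w z hw h1 h2 h3 => by
      have h := hP w z hw h1 h2 (Or.inl h3)
      refine ⟨h.1.resolve_left ?_, h.2⟩
      rintro rfl
      omega) w hw hpos
  refine ⟨p.concat (hP z v hz (by omega) (hg.adj_of_eq_last hgz (by omega)) (Or.inr rfl)).2, ?_⟩
  rw [Walk.length_concat]
  omega

/-- Levels are 1-Lipschitz for the metric of the cycle of length `2 * N`; the last two alternatives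
are the arcs through level `0`. -/
theorem level_le_of_walk (hg : IsCyclicLevel G N v g) {w z : V} (p : G.Walk w z) :
    (g z ≤ g w + p.length ∧ g w ≤ g z + p.length) ∨ 2 * N + g w ≤ g z + p.length ∨
      2 * N + g z ≤ g w + p.length := by
  induction p with
  | nil => simp
  | @cons a b c h p ih =>
    rw [Walk.length_cons]
    have := hg.adj _ _ h
    have := hg.lt a
    have := hg.lt b
    have := hg.lt c
    omega

theorem exists_walk (hg : IsCyclicLevel G N v g) (hN : 0 < N) (w : V) :
    ∃ p : G.Walk w v, p.length = min (g w) (2 * N - g w) := by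
  have hlt := hg.lt w
  rcases le_total (g w) (2 * N - g w) with h | h
  · rw [min_eq_left h]
    exact hg.exists_walk_down (fun _ => True) (fun w z _ _ h _ => ⟨trivial, h⟩) w trivial
  · rw [min_eq_right h]
    obtain ⟨p, hp⟩ := hg.exists_walk_up (K := G) (fun _ => True)
      (fun w z _ _ h _ => ⟨Or.inr trivial, h⟩) w trivial (by omega)
    exact ⟨p, by omega⟩

theorem dist_eq (hg : IsCyclicLevel G N v g) (hN : 0 < N) (w : V) :
    G.dist w v = min (g w) (2 * N - g w) := by
  obtain ⟨p, hp⟩ := hg.exists_walk hN w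
  apply le_antisymm (hp ▸ G.dist_le p)
  obtain ⟨q, hq⟩ := p.reachable.exists_walk_length_eq_dist
  have := hg.level_le_of_walk q
  have := (hg.eq_zero v).2 rfl
  omega

/-- As `v` is alone at level `0`, its removal cuts the cycle open and leaves no way to wrap around.
-/
theorem level_le_of_walk_deleteIncidenceSet (hg : IsCyclicLevel G N v g) {w z : V}
    (p : (G.deleteIncidenceSet v).Walk w z) : g z ≤ g w + p.length := by
  induction p with
  | nil => simp
  | @cons a b _ h p ih =>
    rw [Walk.length_cons]
    rw [deleteIncidenceSet_adj] at h
    have h1 := hg.adj _ _ h.1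
    have h2 := mt (hg.eq_zero a).1 h.2.1
    have h3 := mt (hg.eq_zero b).1 h.2.2
    omega

end IsCyclicLevel

theorem exists_walk_deleteIncidenceSet {x y : V} (p : G.Walk x y) (hp : v ∉ p.support) :
    ∃ q : (G.deleteIncidenceSet v).Walk x y, q.length = p.length := by
  refine ⟨p.transfer _ ?_, p.length_transfer _⟩
  intro e
  induction e with
  | h a b =>
    intro he
    rw [mem_edgeSet, deleteIncidenceSet_adj]
    refine ⟨p.adj_of_mem_edges he, ?_, ?_⟩
    · rintro rfl
      exact hp (p.fst_mem_support_of_mem_edges he)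
    · rintro rfl
      exact hp (p.snd_mem_support_of_mem_edges he)

theorem dist_add_dist_le_of_mem_support {x y : V} (p : G.Walk x y) (hp : v ∈ p.support) :
    G.dist x v + G.dist v y ≤ p.length := by
  classical
  have h1 := G.dist_le (p.takeUntil v hp)
  have h2 := G.dist_le (p.dropUntil v hp)
  have h3 := congrArg Walk.length (p.take_spec hp)
  rw [Walk.length_append] at h3
  omega

/-- Around a deleted vertex `v`, one can walk the other way round. -/
theorem IsCyclicLevel.exists_walk_around (hN : 0 < N) {x y : V} {f : V → ℕ}
    (hf : IsCyclicLevel G N x f) (hxv : x ≠ v) (hyv : y ≠ v) (h : G.dist x v + G.dist v y ≤ N)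
    (hxy : G.dist x y = G.dist x v + G.dist v y) :
    ∃ p : (G.deleteIncidenceSet v).Walk y x, p.length + G.dist x y = 2 * N := by
  have hfv := hf.dist_eq hN v
  have hfy := hf.dist_eq hN y
  rw [dist_comm] at hfv hfy
  have hltv := hf.lt v
  have hlty := hf.lt y
  have hposv := mt (hf.eq_zero v).1 hxv.symm
  have hr : G.Reachable v y :=
    (hf.exists_walk hN v).choose.reachable.trans (hf.exists_walk hN y).choose.reachable.symm
  have hvy := hr.pos_dist_of_ne hyv.symm
  obtain ⟨q, hq⟩ := hr.exists_walk_length_eq_dist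
  have hlip := hf.level_le_of_walk q
  -- Here `f` is centred at `x`, and `v` lies between `x` and `y`, on the lower or the upper half.
  -- Continuing from `y` away from `v` leads monotonically back to `x`.
  rcases le_or_gt (f v) N with hvN | hvN
  · obtain ⟨p, hp⟩ := hf.exists_walk_up (K := G.deleteIncidenceSet v) (fun w => f v < f w)
      (fun w z hw _ hadj hz => by
        rw [deleteIncidenceSet_adj]
        refine ⟨?_, hadj, ?_, ?_⟩
        · rcases hz with hz | hz
          · exact Or.inr (by omega)
          · exact Or.inl hz
        · rintro rfl
          exact lt_irrefl _ hw
        · rintro rfl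
          rcases hz with hz | hz
          · omega
          · exact hxv hz.symm) y (by omega) (by omega)
    exact ⟨p, by omega⟩
  · obtain ⟨p, hp⟩ := hf.exists_walk_down (K := G.deleteIncidenceSet v) (fun w => f w < f v)
      (fun w z hw _ hadj hz => by
        rw [deleteIncidenceSet_adj]
        refine ⟨by omega, hadj, ?_, ?_⟩
        · rintro rfl
          exact lt_irrefl _ hw
        · rintro rfl
          omega) y (by omega)
    exact ⟨p, by omega⟩

/-- The natural subtraction is truncated: there is no growth for level difference at most `N`. The
centred level `f` at `x` bounds the distance by `N` and provides the detour. -/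
theorem IsCyclicLevel.dist_deleteIncidenceSet (hN : 0 < N) {x y : V} {f : V → ℕ}
    (hg : IsCyclicLevel G N v g) (hf : IsCyclicLevel G N x f) (hxv : x ≠ v) (hyv : y ≠ v)
    (hle : g x ≤ g y) :
    (G.deleteIncidenceSet v).Reachable x y ∧
      (G.deleteIncidenceSet v).dist x y = G.dist x y + 2 * (g y - g x - N) := by
  have hxv' := hg.dist_eq hN x
  have hyv' := hg.dist_eq hN y
  rw [dist_comm] at hyv'
  have hx0 := mt (hg.eq_zero x).1 hxv
  have hlx := hg.lt x
  have hly := hg.lt y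
  have hr : G.Reachable x y := (hf.exists_walk hN y).choose.reachable.symm
  have htri := hr.symm.dist_triangle_right v
  obtain ⟨p, hp⟩ := hr.exists_walk_length_eq_dist
  have hrv : G.Reachable v y := (hg.exists_walk hN y).choose.reachable.symm
  have htri : G.dist x y ≤ G.dist x v + G.dist v y := hrv.dist_triangle_right x
  have hmax : G.dist x y ≤ N := by
    rw [dist_comm, hf.dist_eq hN]
    omega
  -- For a large difference, the route through `v` has length `2 * N - (g y - g x) ≤ N`, and every
  -- walk avoiding `v` needs `g y - g x` steps, which the detour attains.
  rcases le_or_gt N (g y - g x) with h | h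
  · have hge : G.dist x v + G.dist v y ≤ G.dist x y := by
      by_cases hmem : v ∈ p.support
      · exact hp ▸ dist_add_dist_le_of_mem_support p hmem
      · obtain ⟨q, hq⟩ := exists_walk_deleteIncidenceSet p hmem
        have := hg.level_le_of_walk_deleteIncidenceSet q
        omega
    have heq := le_antisymm htri hge
    obtain ⟨q, hq⟩ := hf.exists_walk_around hN hxv hyv (heq ▸ hmax) heq
    refine ⟨q.reachable.symm, ?_⟩
    obtain ⟨r, hr⟩ := q.reachable.symm.exists_walk_length_eq_dist
    have h1 := hg.level_le_of_walk_deleteIncidenceSet r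
    have h2 := (G.deleteIncidenceSet v).dist_le q
    rw [dist_comm] at h2
    omega
  · have hmem : v ∉ p.support := by
      intro hmem
      have hge := dist_add_dist_le_of_mem_support p hmem
      -- A geodesic through `v` between vertices on the same half can be shortened by one, since the
      -- neighbours of `v` at a common level are equal or adjacent. On different halves it would be
      -- longer than `N`.
      rcases le_or_gt (g y) N with hyN | hyN
      · obtain ⟨a, -, ha, q, hq⟩ := hg.exists_walk_down_one (K := G) (fun _ => True)
          (fun _ _ _ _ h _ => ⟨trivial, h⟩) x trivial (by omega)
        obtain ⟨b, -, hb, r, hr⟩ := hg.exists_walk_down_one (K := G) (fun _ => True)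
          (fun _ _ _ _ h _ => ⟨trivial, h⟩) y trivial (by omega)
        have hlen : G.dist x y ≤ q.length + 1 + r.length := by
          by_cases hab : a = b
          · subst hab
            have := G.dist_le (q.append r.reverse)
            rw [Walk.length_append, Walk.length_reverse] at this
            omega
          · have hadj := hg.clique a b (hg.adj_of_eq_one ha).symm (hg.adj_of_eq_one hb).symm
              (ha.trans hb.symm) hab
            have := G.dist_le ((q.concat hadj).append r.reverse)
            rwa [Walk.length_append, Walk.length_reverse, Walk.length_concat] at this
        omega
      · rcases le_or_gt N (g x) with hxN | hxN
        · obtain ⟨a, -, ha, q, hq⟩ := hg.exists_walk_up_one (K := G) (fun _ => True)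
            (fun _ _ _ _ h _ => ⟨trivial, h⟩) x trivial (by omega)
          obtain ⟨b, -, hb, r, hr⟩ := hg.exists_walk_up_one (K := G) (fun _ => True)
            (fun _ _ _ _ h _ => ⟨trivial, h⟩) y trivial (by omega)
          have hlen : G.dist x y ≤ q.length + 1 + r.length := by
            by_cases hab : a = b
            · subst hab
              have := G.dist_le (q.append r.reverse)
              rw [Walk.length_append, Walk.length_reverse] at this
              omega
            · have hadj := hg.clique a b (hg.adj_of_eq_last ha (by omega)).symm
                (hg.adj_of_eq_last hb (by omega)).symm (by omega) hab
              have := G.dist_le ((q.concat hadj).append r.reverse)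
              rwa [Walk.length_append, Walk.length_reverse, Walk.length_concat] at this
          omega
        · omega
    obtain ⟨q, hq⟩ := exists_walk_deleteIncidenceSet p hmem
    refine ⟨q.reachable, ?_⟩
    have h1 := (G.deleteIncidenceSet v).dist_le q
    have h2 := q.reachable.dist_anti (G.deleteIncidenceSet_le v)
    omega

end CyclicLevel

/-! ### The arc-graph of a Moore graph wrapped around a cycle -/

section ArcLevel

theorem card_dart_of_isRegularOfDegree {V : Type*} [Fintype V] {M : SimpleGraph V}
    [DecidableRel M.Adj] {d : ℕ} (hreg : M.IsRegularOfDegree d) :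
    Fintype.card M.Dart = Fintype.card V * d := by
  rw [dart_card_eq_sum_degrees, Finset.sum_congr rfl fun x _ => hreg x, Finset.sum_const,
    Finset.card_univ, smul_eq_mul]

theorem arcGraph_adj {V : Type*} {M : SimpleGraph V} {a b : M.Dart} :
    (arcGraph M).Adj a b ↔ b = a.symm ∨ (a ≠ b ∧ a.fst = b.fst) := Iff.rfl

variable {V : Type*} {M : SimpleGraph V} {d k : ℕ}

/-- The position of the arc `a` on a cycle of length `4 * k + 4` through the arc `e`. -/
noncomputable def arcLevel (M : SimpleGraph V) (k : ℕ) (e a : M.Dart) : ℕ :=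
  2 * position M k e.fst e.snd a.fst + if IsForward M k e.fst e.snd a.fst a.snd then 1 else 0

/-- The number of arcs at the level `n`. -/
def arcLevelCard (d k n : ℕ) : ℕ :=
  if n / 2 ≤ k then (d - 1) ^ (n / 2 + n % 2) else (d - 1) ^ (2 * k + 1 - n / 2 + (1 - n % 2))

theorem arcLevel_eq_iff {e a : M.Dart} {n : ℕ} : arcLevel M k e a = n ↔
    position M k e.fst e.snd a.fst = n / 2 ∧
      (IsForward M k e.fst e.snd a.fst a.snd ↔ n % 2 = 1) := by
  rw [arcLevel]
  split_ifs with h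
  · simp only [h, true_iff]
    omega
  · simp only [h, false_iff]
    omega

variable [Fintype V] [DecidableEq V] [DecidableRel M.Adj]

theorem card_filter_dart (P : V → Prop) [DecidablePred P] (Q : V → V → Prop)
    [∀ x y, Decidable (Q x y)] {m : ℕ}
    (hm : ∀ x, P x → ((M.neighborFinset x).filter fun y => Q x y).card = m) :
    (Finset.univ.filter fun a : M.Dart => P a.fst ∧ Q a.fst a.snd).card =
      (Finset.univ.filter P).card * m := by
  rw [Finset.card_eq_sum_card_fiberwise (f := fun a : M.Dart => a.fst)
    (t := Finset.univ.filter P) (by intro a ha; simp at ha ⊢; exact ha.1)]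
  refine Finset.sum_const_nat fun x hx => ?_
  have hx := (Finset.mem_filter.1 hx).2
  rw [← hm x hx]
  refine Finset.card_bij (fun a _ => a.snd) ?_ ?_ ?_
  · intro a ha
    simp only [Finset.mem_filter, Finset.mem_univ, true_and] at ha
    obtain ⟨⟨-, h⟩, rfl⟩ := ha
    exact Finset.mem_filter.2 ⟨(M.mem_neighborFinset _ _).2 a.adj, h⟩
  · intro a ha b hb hab
    simp only [Finset.mem_filter, Finset.mem_univ, true_and] at ha hb
    exact Dart.ext _ _ (Prod.ext (ha.2.trans hb.2.symm) hab)
  · intro y hy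
    rw [Finset.mem_filter, mem_neighborFinset] at hy
    exact ⟨⟨(x, y), hy.1⟩, by simpa using ⟨hx, hy.2⟩, rfl⟩

/-- Level `2 * p` holds the backward arcs rooted at position `p`, and level `2 * p + 1` the forward
ones. -/
theorem IsMooreGraph.card_arcLevel_eq (hM : IsMooreGraph M d (k + 1)) (hk : 0 < k) (e : M.Dart)
    {n : ℕ} (hn : n < 4 * k + 4) :
    (Finset.univ.filter fun a => arcLevel M k e a = n).card = arcLevelCard d k n := by
  have hswap : 2 * k + 1 - (2 * k + 1 - n / 2) = n / 2 := by omega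
  simp only [arcLevel_eq_iff]
  rw [arcLevelCard]
  rcases Nat.mod_two_eq_zero_or_one n with h | h
  · simp only [h, zero_ne_one, iff_false]
    split_ifs with hnk
    · rw [card_filter_dart (fun x => position M k e.fst e.snd x = n / 2)
        (fun x y => ¬ IsForward M k e.fst e.snd x y)
        (fun x hx => hM.card_not_isForward hk e.adj (hx.trans_le hnk)),
        hM.card_position_eq e.adj hnk, mul_one, add_zero]
    · rw [card_filter_dart (fun x => position M k e.fst e.snd x = n / 2)
        (fun x y => ¬ IsForward M k e.fst e.snd x y)
        (fun x hx => hM.card_not_isForward_of_lt hk e.adj (hx ▸ not_le.1 hnk)), ← hswap,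
        hM.card_position_eq_sub e.adj (by omega), hswap, pow_succ]
  · simp only [h, iff_true]
    split_ifs with hnk
    · rw [card_filter_dart (fun x => position M k e.fst e.snd x = n / 2)
        (fun x y => IsForward M k e.fst e.snd x y)
        (fun x hx => hM.card_isForward_of_le hk e.adj (hx.trans_le hnk)),
        hM.card_position_eq e.adj hnk, pow_succ]
    · rw [card_filter_dart (fun x => position M k e.fst e.snd x = n / 2)
        (fun x y => IsForward M k e.fst e.snd x y)
        (fun x hx => hM.card_isForward_of_lt hk e.adj (hx ▸ not_le.1 hnk)), ← hswap,
        hM.card_position_eq_sub e.adj (by omega), hswap, mul_one, Nat.sub_self, add_zero]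

theorem IsMooreGraph.exists_isForward (hM : IsMooreGraph M d (k + 1)) (hk : 0 < k) (hd : 1 < d)
    {v u : V} (hvu : M.Adj v u) (x : V) : ∃ y, M.Adj x y ∧ IsForward M k v u x y := by
  have h : 0 < ((M.neighborFinset x).filter fun y => IsForward M k v u x y).card := by
    rcases le_or_gt (position M k v u x) k with h | h
    · rw [hM.card_isForward_of_le hk hvu h]
      omega
    · rw [hM.card_isForward_of_lt hk hvu h]
      omega
  obtain ⟨y, hy⟩ := Finset.card_pos.1 h
  rw [Finset.mem_filter, mem_neighborFinset] at hy
  exact ⟨y, hy⟩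

theorem IsMooreGraph.exists_not_isForward (hM : IsMooreGraph M d (k + 1)) (hk : 0 < k)
    (hd : 1 < d) {v u : V} (hvu : M.Adj v u) (x : V) :
    ∃ y, M.Adj x y ∧ ¬ IsForward M k v u x y := by
  obtain ⟨y, hxy, hy⟩ := hM.exists_isForward hk hd hvu.symm x
  exact ⟨y, hxy, (hM.isForward_swap hk hvu hxy).1 hy⟩

theorem IsMooreGraph.arcLevel_eq_zero (hM : IsMooreGraph M d (k + 1)) (hk : 0 < k)
    (e a : M.Dart) : arcLevel M k e a = 0 ↔ a = e := by
  rw [arcLevel_eq_iff]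
  simp only [Nat.zero_div, Nat.zero_mod, zero_ne_one, iff_false, hM.position_eq_zero e.adj]
  constructor
  · rintro ⟨h1, h2⟩
    have h3 := hM.position_adj e.adj a.adj
    have h4 := (hM.position_eq_zero e.adj).2 h1
    rw [IsForward] at h2
    refine Dart.ext _ _ (Prod.ext h1 ((hM.position_eq_last e.adj).1 ?_))
    omega
  · rintro rfl
    refine ⟨rfl, ?_⟩
    rw [IsForward, (hM.position_eq_zero a.adj).2 rfl, (hM.position_eq_last a.adj).2 rfl]
    omega

theorem IsMooreGraph.arcLevel_symm (hM : IsMooreGraph M d (k + 1)) (hk : 0 < k)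
    (e a : M.Dart) :
    (arcLevel M k e a % 2 = 1 → arcLevel M k e a.symm = arcLevel M k e a + 1 ∨
      (arcLevel M k e a + 1 = 4 * k + 4 ∧ arcLevel M k e a.symm = 0)) ∧
    (arcLevel M k e a % 2 = 0 → arcLevel M k e a = arcLevel M k e a.symm + 1 ∨
      (arcLevel M k e a = 0 ∧ arcLevel M k e a.symm + 1 = 4 * k + 4)) := by
  have h := hM.position_adj e.adj a.adj
  have h1 := hM.position_le e.adj a.fst
  have h2 := hM.position_le e.adj a.snd
  have ha : arcLevel M k e a.symm = 2 * position M k e.fst e.snd a.snd +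
    if IsForward M k e.fst e.snd a.snd a.fst then 1 else 0 := rfl
  rw [ha, arcLevel]
  split_ifs with h3 h4 h4 <;> rw [IsForward] at h3 h4 <;> omega

/-- Levels rise by alternately turning a backward arc into a forward one at the same root and
reversing a forward arc, which then points backward from the next position. -/
theorem IsMooreGraph.isCyclicLevel_arcLevel (hM : IsMooreGraph M d (k + 1)) (hk : 0 < k)
    (hd : 1 < d) (e : M.Dart) :
    IsCyclicLevel (arcGraph M) (2 * k + 2) e (arcLevel M k e) where
  lt a := by
    have h1 := hM.position_le e.adj a.fst
    rw [arcLevel]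
    split_ifs <;> omega
  eq_zero a := hM.arcLevel_eq_zero hk e a
  adj a b h := by
    rw [arcGraph_adj] at h
    rcases h with rfl | ⟨-, h⟩
    · have := hM.arcLevel_symm hk e a
      omega
    · rw [arcLevel, arcLevel, h]
      split_ifs <;> omega
  exists_down a hpos := by
    have hs := hM.arcLevel_symm hk e a
    rcases Nat.mod_two_eq_zero_or_one (arcLevel M k e a) with h | h
    · exact ⟨a.symm, Or.inl rfl, by omega⟩
    · obtain ⟨y, hy, hf⟩ := hM.exists_not_isForward hk hd e.adj a.fst
      have h1 := (arcLevel_eq_iff.1 (rfl : arcLevel M k e a = _)).2.2 h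
      refine ⟨⟨(a.fst, y), hy⟩, Or.inr ⟨?_, rfl⟩, ?_⟩
      · intro h
        apply hf
        rw [h] at h1
        exact h1
      · simp [arcLevel, hf, h1]
  exists_up a hpos := by
    have hs := hM.arcLevel_symm hk e a
    rcases Nat.mod_two_eq_zero_or_one (arcLevel M k e a) with h | h
    · obtain ⟨y, hy, hf⟩ := hM.exists_isForward hk hd e.adj a.fst
      have h1 : ¬ IsForward M k e.fst e.snd a.fst a.snd := fun h' => by
        have := (arcLevel_eq_iff.1 (rfl : arcLevel M k e a = _)).2.1 h'
        omega
      refine ⟨⟨(a.fst, y), hy⟩, Or.inr ⟨?_, rfl⟩, Or.inl ?_⟩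
      · intro h
        apply h1
        rw [h]
        exact hf
      · simp [arcLevel, hf, h1]
    · refine ⟨a.symm, Or.inl rfl, ?_⟩
      rcases hs.1 h with h' | ⟨h', h''⟩
      · exact Or.inl h'
      · exact Or.inr ⟨by omega, (hM.arcLevel_eq_zero hk e _).1 h''⟩
  clique a b ha hb hab hne := by
    rw [arcGraph_adj] at ha hb ⊢
    have hs := hM.arcLevel_symm hk e e
    have h0 := (hM.arcLevel_eq_zero hk e e).2 rfl
    -- This separates `e.symm`, at the last level, from the neighbours that share the root of `e`
    -- and so form a clique.
    have key : ∀ c : M.Dart, e.fst = c.fst → arcLevel M k e c ≤ 1 := by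
      intro c hc
      rw [arcLevel, ← hc, (hM.position_eq_zero e.adj).2 rfl]
      split_ifs <;> omega
    rcases ha with rfl | ⟨-, ha⟩ <;> rcases hb with rfl | ⟨-, hb⟩
    · exact absurd rfl hne
    · have := key b hb
      omega
    · have := key a ha
      omega
    · exact Or.inr ⟨hne, ha.symm.trans hb⟩

theorem IsMooreGraph.arcLevel_symm_self (hM : IsMooreGraph M d (k + 1)) (hk : 0 < k)
    (e : M.Dart) : arcLevel M k e e.symm + 1 = 4 * k + 4 := by
  have hs := hM.arcLevel_symm hk e e
  have h0 := (hM.arcLevel_eq_zero hk e e).2 rfl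
  omega

theorem arcGraph_isRegularOfDegree (hreg : M.IsRegularOfDegree d) :
    (arcGraph M).IsRegularOfDegree d := by
  intro a
  have hd : 0 < d := by
    rw [← hreg a.fst]
    exact (degree_pos_iff_exists_adj M a.fst).2 ⟨a.snd, a.adj⟩
  have h : (arcGraph M).neighborFinset a =
      insert a.symm ((Finset.univ.filter fun b : M.Dart => b.fst = a.fst).erase a) := by
    ext b
    rw [mem_neighborFinset, arcGraph_adj, Finset.mem_insert, Finset.mem_erase, Finset.mem_filter,
      and_iff_right (Finset.mem_univ b), ne_comm, eq_comm (a := a.fst)]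
  rw [← card_neighborFinset_eq_degree, h, Finset.card_insert_of_notMem,
    Finset.card_erase_of_mem (by simp), dart_fst_fiber_card_eq_degree, hreg]
  · omega
  · intro hmem
    have := (Finset.mem_filter.1 (Finset.mem_of_mem_erase hmem)).2
    exact a.adj.ne this.symm

end ArcLevel

/-! ### Maps that may contract edges -/

section WeakHom

variable {V W : Type*} {G : SimpleGraph V} {G' : SimpleGraph W}

theorem exists_walk_map {f : V → W}
    (hf : ∀ x y, G.Adj x y → f x = f y ∨ G'.Adj (f x) (f y)) {x y : V} (p : G.Walk x y) :
    ∃ q : G'.Walk (f x) (f y), q.length ≤ p.length := by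
  induction p with
  | nil => exact ⟨Walk.nil, le_rfl⟩
  | @cons a b c h p ih =>
    obtain ⟨q, hq⟩ := ih
    rcases hf a b h with h' | h'
    · rw [h']
      exact ⟨q, hq.trans (by rw [Walk.length_cons]; omega)⟩
    · exact ⟨Walk.cons h' q, by rw [Walk.length_cons, Walk.length_cons]; omega⟩

theorem reachable_map {f : V → W}
    (hf : ∀ x y, G.Adj x y → f x = f y ∨ G'.Adj (f x) (f y)) {x y : V} (h : G.Reachable x y) :
    G'.Reachable (f x) (f y) := by
  obtain ⟨p⟩ := h
  exact (exists_walk_map hf p).choose.reachable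

theorem dist_map_le {f : V → W}
    (hf : ∀ x y, G.Adj x y → f x = f y ∨ G'.Adj (f x) (f y)) {x y : V} (h : G.Reachable x y) :
    G'.dist (f x) (f y) ≤ G.dist x y := by
  obtain ⟨p, hp⟩ := h.exists_walk_length_eq_dist
  obtain ⟨q, hq⟩ := exists_walk_map hf p
  exact hp ▸ (G'.dist_le q).trans hq

/-- Used for retractions: the two maps need be mutually inverse only at the endpoints in question.
Without reachability both distances have the default value `0`. -/
theorem dist_eq_of_map {f : V → W} {f' : W → V}
    (hf : ∀ x y, G.Adj x y → f x = f y ∨ G'.Adj (f x) (f y))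
    (hf' : ∀ x y, G'.Adj x y → f' x = f' y ∨ G.Adj (f' x) (f' y)) {x y : V} {x' y' : W}
    (hx : f x = x') (hy : f y = y') (hx' : f' x' = x) (hy' : f' y' = y) :
    G.dist x y = G'.dist x' y' := by
  by_cases h : G.Reachable x y
  · have h' := reachable_map hf h
    have h1 := dist_map_le hf h
    have h2 := dist_map_le hf' h'
    rw [hx, hy] at h1
    rw [hx, hy, hx', hy'] at h2
    exact le_antisymm h2 h1
  · have h' : ¬ G'.Reachable x' y' := fun h' => h (by
      have := reachable_map hf' h'
      rwa [hx', hy'] at this)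
    rw [dist_eq_zero_of_not_reachable h, dist_eq_zero_of_not_reachable h']

theorem le_add_length_of_walk {f : V → ℤ} (hf : ∀ x y, G.Adj x y → f x ≤ f y + 1) {x y : V}
    (p : G.Walk x y) : f x ≤ f y + p.length := by
  induction p with
  | nil => simp
  | @cons a b _ h p ih =>
    have := hf a b h
    rw [Walk.length_cons]
    push_cast
    omega

theorem of_reachable {P : V → Prop} (hP : ∀ x y, G.Adj x y → P x → P y) {x y : V}
    (h : G.Reachable x y) (hx : P x) : P y := by
  obtain ⟨p⟩ := h
  induction p with
  | nil => exact hx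
  | cons h p ih => exact ih (hP _ _ h hx)

end WeakHom

/-! ### Total distance as a sum over ordered pairs -/

section Wiener

variable {V : Type*} {G : SimpleGraph V} {v : V}

/-- `deleteIncidenceSet` keeps the vertex type and isolates `v`, whose distances become the default
`0`; sums over all of `V` thus compute the total distance of `G ∖ v`. -/
theorem dist_deleteIncidenceSet_self (y : V) : (G.deleteIncidenceSet v).dist v y = 0 := by
  by_cases h : (G.deleteIncidenceSet v).Reachable v y
  · have : y = v := of_reachable (P := fun y => y = v) (fun a b hab ha => by
      rw [deleteIncidenceSet_adj] at hab
      exact absurd ha hab.2.1) h rfl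
    rw [this, dist_self]
  · exact dist_eq_zero_of_not_reachable h

theorem dist_deleteIncidenceSet_self_right (x : V) : (G.deleteIncidenceSet v).dist x v = 0 := by
  rw [dist_comm, dist_deleteIncidenceSet_self]

theorem adj_val_of_adj_deleteVertex (x y : ↥({v}ᶜ : Set V)) (h : (deleteVertex G v).Adj x y) :
    x.1 = y.1 ∨ (G.deleteIncidenceSet v).Adj x y :=
  Or.inr (deleteIncidenceSet_adj.2 ⟨h, x.2, y.2⟩)

theorem adj_deleteVertex_of_adj [DecidableEq V] (x₀ : ↥({v}ᶜ : Set V)) (x y : V)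
    (h : (G.deleteIncidenceSet v).Adj x y) :
    (if h : x ≠ v then ⟨x, h⟩ else x₀ : ↥({v}ᶜ : Set V)) =
        (if h : y ≠ v then ⟨y, h⟩ else x₀ : ↥({v}ᶜ : Set V)) ∨
      (deleteVertex G v).Adj (if h : x ≠ v then ⟨x, h⟩ else x₀ : ↥({v}ᶜ : Set V))
        (if h : y ≠ v then ⟨y, h⟩ else x₀ : ↥({v}ᶜ : Set V)) := by
  rw [deleteIncidenceSet_adj] at h
  rw [dif_pos h.2.1, dif_pos h.2.2]
  exact Or.inr h.1

theorem dist_deleteVertex (x y : ↥({v}ᶜ : Set V)) :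
    (deleteVertex G v).dist x y = (G.deleteIncidenceSet v).dist x y := by
  classical
  exact dist_eq_of_map (f := Subtype.val) adj_val_of_adj_deleteVertex
    (adj_deleteVertex_of_adj x) rfl rfl (dif_pos x.2) (dif_pos y.2)

theorem reachable_deleteVertex {x y : V} (hx : x ≠ v) (hy : y ≠ v) :
    (deleteVertex G v).Reachable ⟨x, hx⟩ ⟨y, hy⟩ ↔ (G.deleteIncidenceSet v).Reachable x y := by
  classical
  refine ⟨reachable_map adj_val_of_adj_deleteVertex, fun h => ?_⟩
  have := reachable_map (adj_deleteVertex_of_adj ⟨x, hx⟩) h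
  rwa [dif_pos hx, dif_pos hy] at this

variable [Fintype V]

theorem two_mul_wienerIndex (G : SimpleGraph V) :
    2 * wienerIndex G = ∑ x, ∑ y, G.dist x y := by
  classical
  rw [wienerIndex, finsum_eq_sum_of_fintype, ← Fintype.sum_prod_type',
    ← Finset.sum_fiberwise (Finset.univ : Finset (V × V)) (fun q => s(q.1, q.2)), Finset.mul_sum]
  refine Finset.sum_congr rfl fun e _ => ?_
  induction e with
  | h a b =>
    change 2 * G.dist a b = _
    by_cases hab : a = b
    · subst hab
      rw [dist_self, mul_zero, eq_comm]
      refine Finset.sum_eq_zero fun q hq => ?_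
      have h := (Finset.mem_filter.1 hq).2
      rw [Sym2.eq_iff] at h
      obtain ⟨h1, h2⟩ | ⟨h1, h2⟩ := h <;> rw [h1, h2, dist_self]
    · have h : (Finset.univ.filter fun q : V × V => s(q.1, q.2) = s(a, b)) =
          {(a, b), (b, a)} := by
        ext ⟨x, y⟩
        simp
      rw [h, Finset.sum_pair (by simp [hab]), G.dist_comm (u := b), two_mul]

theorem two_mul_wienerIndex_deleteVertex (G : SimpleGraph V) (v : V) :
    2 * wienerIndex (deleteVertex G v) = ∑ x, ∑ y, (G.deleteIncidenceSet v).dist x y := by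
  classical
  have key : ∀ f : V → ℕ, f v = 0 → ∑ x, f x = ∑ x : ↥({v}ᶜ : Set V), f x := by
    intro f hf
    rw [← Finset.sum_subtype ({v}ᶜ : Finset V) (by simp) f]
    refine (Finset.sum_subset (Finset.subset_univ _) fun x _ hx => ?_).symm
    rw [Finset.mem_compl, not_not, Finset.mem_singleton] at hx
    rw [hx, hf]
  rw [two_mul_wienerIndex, key _ (Finset.sum_eq_zero fun y _ => dist_deleteIncidenceSet_self y)]
  refine Finset.sum_congr rfl fun x _ => ?_
  rw [key _ (dist_deleteIncidenceSet_self_right _)]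
  exact Finset.sum_congr rfl fun y _ => dist_deleteVertex x y

/-- Deleting a leaf decreases the total distance. -/
theorem wienerIndex_deleteVertex_lt_of_leaf {u : V} (hG : G.Connected) (hvu : G.Adj v u)
    (hleaf : ∀ z, G.Adj v z → z = u) : wienerIndex (deleteVertex G v) < wienerIndex G := by
  classical
  have hle : ∀ x y, (G.deleteIncidenceSet v).dist x y ≤ G.dist x y := by
    intro x y
    rcases eq_or_ne x v with rfl | hx
    · rw [dist_deleteIncidenceSet_self]
      exact Nat.zero_le _
    rcases eq_or_ne y v with rfl | hy
    · rw [dist_deleteIncidenceSet_self_right]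
      exact Nat.zero_le _
    -- Folding the leaf onto its neighbour does not increase distances.
    have := dist_map_le (G := G) (G' := G.deleteIncidenceSet v)
      (f := fun x => if x = v then u else x) (fun a b hab => by
        split_ifs with ha hb hb
        · exact Or.inl rfl
        · subst ha
          exact Or.inl (hleaf b hab).symm
        · subst hb
          exact Or.inl (hleaf a hab.symm)
        · exact Or.inr (deleteIncidenceSet_adj.2 ⟨hab, ha, hb⟩)) (hG x y)
    rwa [if_neg hx, if_neg hy] at this
  have h : 2 * wienerIndex (deleteVertex G v) < 2 * wienerIndex G := by
    rw [two_mul_wienerIndex_deleteVertex, two_mul_wienerIndex]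
    refine Finset.sum_lt_sum (fun x _ => Finset.sum_le_sum fun y _ => hle x y)
      ⟨v, Finset.mem_univ v, Finset.sum_lt_sum (fun y _ => hle v y) ⟨u, Finset.mem_univ u, ?_⟩⟩
    rw [dist_deleteIncidenceSet_self, dist_eq_one_iff_adj.2 hvu]
    exact Nat.zero_lt_one
  omega

end Wiener

/-! ### Change of the total distance from level sizes -/

section CyclicLevelSum

variable {V : Type*} {G : SimpleGraph V} {N : ℕ} {v : V} {g : V → ℕ}

/-- The growth of the distance between two vertices at the levels `a` and `b` when the vertex at
the level `0` is deleted. -/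
def levelGrowth (N a b : ℕ) : ℕ :=
  if a = 0 ∨ b = 0 then 0 else 2 * (a - b + (b - a) - N)

theorem IsCyclicLevel.dist_deleteIncidenceSet_add [DecidableEq V] (hN : 0 < N)
    (hG : ∀ x, ∃ f, IsCyclicLevel G N x f) (hg : IsCyclicLevel G N v g) (x y : V) :
    (G.deleteIncidenceSet v).dist x y +
        ((if x = v then G.dist v y else 0) + if y = v then G.dist v x else 0) =
      G.dist x y + levelGrowth N (g x) (g y) := by
  rcases eq_or_ne x v with rfl | hx
  · have h0 := (hg.eq_zero x).2 rfl
    rw [dist_deleteIncidenceSet_self, if_pos rfl, levelGrowth, if_pos (Or.inl h0)]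
    simp
  rcases eq_or_ne y v with rfl | hy
  · have h0 := (hg.eq_zero y).2 rfl
    rw [dist_deleteIncidenceSet_self_right, if_pos rfl, levelGrowth, if_pos (Or.inr h0),
      if_neg hx, G.dist_comm (u := y)]
    simp
  have hx0 := mt (hg.eq_zero x).1 hx
  have hy0 := mt (hg.eq_zero y).1 hy
  rw [if_neg hx, if_neg hy, levelGrowth, if_neg (by simp [hx0, hy0])]
  rcases le_total (g x) (g y) with h | h
  · obtain ⟨f, hf⟩ := hG x
    rw [(hg.dist_deleteIncidenceSet hN hf hx hy h).2]
    omega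
  · obtain ⟨f, hf⟩ := hG y
    rw [dist_comm, (hg.dist_deleteIncidenceSet hN hf hy hx h).2, G.dist_comm]
    omega

theorem IsCyclicLevel.sum_dist_deleteIncidenceSet [Fintype V] (hN : 0 < N)
    (hG : ∀ x, ∃ f, IsCyclicLevel G N x f) (hg : IsCyclicLevel G N v g) :
    ∑ x, ∑ y, (G.deleteIncidenceSet v).dist x y + 2 * ∑ x, min (g x) (2 * N - g x) =
      ∑ x, ∑ y, G.dist x y + ∑ x, ∑ y, levelGrowth N (g x) (g y) := by
  classical
  have h : ∑ x, min (g x) (2 * N - g x) = ∑ x, G.dist v x :=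
    Finset.sum_congr rfl fun x _ => by rw [dist_comm, hg.dist_eq hN]
  have h' : ∑ x, ∑ y, ((if x = v then G.dist v y else 0) + if y = v then G.dist v x else 0) =
      2 * ∑ x, G.dist v x := by
    simp only [Finset.sum_add_distrib]
    rw [Finset.sum_comm]
    simp [two_mul]
  rw [h, ← h']
  simp only [← Finset.sum_add_distrib]
  exact Finset.sum_congr rfl fun x _ => Finset.sum_congr rfl fun y _ =>
    hg.dist_deleteIncidenceSet_add hN hG x y

theorem sum_comp_level [Fintype V] {m : ℕ} (hlt : ∀ x, g x < m) {c : ℕ → ℕ}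
    (hc : ∀ n < m, (Finset.univ.filter fun x => g x = n).card = c n) (F : ℕ → ℕ) :
    ∑ x, F (g x) = ∑ n ∈ Finset.range m, c n * F n := by
  rw [← Finset.sum_fiberwise_of_maps_to (t := Finset.range m)
    (fun x _ => Finset.mem_range.2 (hlt x))]
  refine Finset.sum_congr rfl fun n hn => ?_
  rw [← hc n (Finset.mem_range.1 hn)]
  exact Finset.sum_const_nat fun x hx => by rw [(Finset.mem_filter.1 hx).2]

end CyclicLevelSum

/-! ### Attaching a tree at an edge -/

section AttachTree

variable {V : Type*} {G : SimpleGraph V} {a b : V} {n p : ℕ}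

theorem attachTree_adj {x y : V ⊕ Fin n ⊕ Unit} :
    (attachTree G a b n p).Adj x y ↔ attachTreeAdj G a b n p x y := Iff.rfl

/-- The distance of a vertex of the attached tree from the ends of the edge `ab`. -/
def treeDepth (n p : ℕ) : Fin n ⊕ Unit → ℕ
  | .inl i => i + 1
  | .inr _ => p + 2

/-- The ends of the edge `ab` at level `0`, with `L` measuring the distance from them. -/
structure IsEdgeDepth (G : SimpleGraph V) (a b : V) (L : V → ℕ) : Prop where
  left : L a = 0
  right : L b = 0
  adj (x y : V) : G.Adj x y → L x ≤ L y + 1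

variable {L : V → ℕ}

/-- The potential `L` on `G`, continued by minus the depth on the tree, drops by at most one along
any edge. -/
theorem IsEdgeDepth.add_treeDepth_le_length (hL : IsEdgeDepth G a b L) {w : V}
    {t : Fin n ⊕ Unit} (q : (attachTree G a b n p).Walk (.inl w) (.inr t)) :
    L w + treeDepth n p t ≤ q.length := by
  have h := le_add_length_of_walk
    (f := Sum.elim (fun w => (L w : ℤ)) (fun t => -(treeDepth n p t : ℤ))) ?_ q
  · simp only [Sum.elim_inl, Sum.elim_inr] at h
    omega
  · have hl := hL.left
    have hr := hL.right
    rintro (x | i | ⟨⟩) (y | j | ⟨⟩) hxy <;> rw [attachTree_adj] at hxy <;>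
      simp only [attachTreeAdj, Sum.elim_inl, Sum.elim_inr, treeDepth] at hxy ⊢
    · have := hL.adj x y hxy
      omega
    · obtain ⟨rfl | rfl, h0⟩ := hxy <;> omega
    · omega
    · omega
    · omega
    · omega

variable {K : SimpleGraph (V ⊕ Fin n ⊕ Unit)}

theorem exists_walk_root (hn : 0 < n) (hp : p < n)
    (hK : ∀ t t', (attachTree G a b n p).Adj (.inr t) (.inr t') → K.Adj (.inr t) (.inr t'))
    (t : Fin n ⊕ Unit) :
    ∃ q : K.Walk (.inr (.inl ⟨0, hn⟩)) (.inr t), q.length + 1 = treeDepth n p t := by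
  have key : ∀ i (hi : i < n),
      ∃ q : K.Walk (.inr (.inl ⟨0, hn⟩)) (.inr (.inl ⟨i, hi⟩)), q.length = i := by
    intro i
    induction i with
    | zero => exact fun _ => ⟨Walk.nil, rfl⟩
    | succ i ih =>
      intro hi
      obtain ⟨q, hq⟩ := ih (by omega)
      exact ⟨q.concat (hK (.inl ⟨i, by omega⟩) (.inl ⟨i + 1, hi⟩) (Or.inl rfl)),
        by rw [Walk.length_concat, hq]⟩
  rcases t with ⟨i, hi⟩ | ⟨⟩
  · obtain ⟨q, hq⟩ := key i hi
    exact ⟨q, by rw [hq, treeDepth]⟩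
  · obtain ⟨q, hq⟩ := key p hp
    exact ⟨q.concat (hK (.inl ⟨p, hp⟩) (.inr ()) rfl), by rw [Walk.length_concat, hq, treeDepth]⟩

theorem exists_walk_tree (hn : 0 < n) (hp : p < n)
    (hK : ∀ t t', (attachTree G a b n p).Adj (.inr t) (.inr t') → K.Adj (.inr t) (.inr t'))
    {w c : V} (hc : K.Adj (.inl c) (.inr (.inl ⟨0, hn⟩))) (q : K.Walk (.inl w) (.inl c))
    (t : Fin n ⊕ Unit) :
    ∃ r : K.Walk (.inl w) (.inr t), r.length = q.length + treeDepth n p t := by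
  obtain ⟨r, hr⟩ := exists_walk_root hn hp hK t
  refine ⟨q.append (Walk.cons hc r), ?_⟩
  rw [Walk.length_append, Walk.length_cons, hr]

theorem attachTree_adj_root {c : V} (hn : 0 < n) (hc : c = a ∨ c = b) :
    (attachTree G a b n p).Adj (.inl c) (.inr (.inl ⟨0, hn⟩)) := ⟨hc, rfl⟩

theorem exists_walk_attachTree (hn : 0 < n) (hp : p < n) {w c : V} (hc : c = a ∨ c = b)
    (q : G.Walk w c) (t : Fin n ⊕ Unit) :
    ∃ r : (attachTree G a b n p).Walk (.inl w) (.inr t),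
      r.length = q.length + treeDepth n p t := by
  obtain ⟨r, hr⟩ := exists_walk_tree (K := attachTree G a b n p) hn hp (fun _ _ h => h)
    (attachTree_adj_root hn hc) (q.map (⟨.inl, fun h => h⟩ : G →g attachTree G a b n p)) t
  exact ⟨r, by rwa [Walk.length_map] at hr⟩

theorem exists_walk_attachTree_deleteIncidenceSet (hn : 0 < n) (hp : p < n) {v w c : V}
    (hc : c = a ∨ c = b) (hcv : c ≠ v) (q : (G.deleteIncidenceSet v).Walk w c)
    (t : Fin n ⊕ Unit) :
    ∃ r : ((attachTree G a b n p).deleteIncidenceSet (.inl v)).Walk (.inl w) (.inr t),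
      r.length = q.length + treeDepth n p t := by
  obtain ⟨r, hr⟩ := exists_walk_tree (K := (attachTree G a b n p).deleteIncidenceSet (.inl v))
    hn hp (fun _ _ h => deleteIncidenceSet_adj.2 ⟨h, Sum.inr_ne_inl, Sum.inr_ne_inl⟩)
    (deleteIncidenceSet_adj.2 ⟨attachTree_adj_root hn hc, by simpa using hcv, Sum.inr_ne_inl⟩)
    (q.map (⟨.inl, fun {x y} h => by
      rw [deleteIncidenceSet_adj] at h ⊢
      exact ⟨h.1, by simpa using h.2.1, by simpa using h.2.2⟩⟩ :
      G.deleteIncidenceSet v →g (attachTree G a b n p).deleteIncidenceSet (.inl v))) t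
  exact ⟨r, by rwa [Walk.length_map] at hr⟩

/-- Collapsing the tree to `a` is a retraction, because `ab` is an edge; so the tree gives no
shortcut. -/
theorem dist_attachTree_inl (x y : V) (hab : G.Adj a b) :
    (attachTree G a b n p).dist (.inl x) (.inl y) = G.dist x y := by
  refine dist_eq_of_map (f := Sum.elim id fun _ => a) (f' := Sum.inl) ?_
    (fun x y h => Or.inr h) rfl rfl rfl rfl
  rintro (x | i | ⟨⟩) (y | j | ⟨⟩) hxy <;> rw [attachTree_adj] at hxy <;>
    simp only [attachTreeAdj, Sum.elim_inl, Sum.elim_inr, id_eq, true_or] at hxy ⊢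
  · exact Or.inr hxy
  · obtain ⟨rfl | rfl, -⟩ := hxy
    · exact Or.inl rfl
    · exact Or.inr hab.symm
  · obtain ⟨rfl | rfl, -⟩ := hxy
    · exact Or.inl rfl
    · exact Or.inr hab

/-- At least one end `c` of the edge survives the deletion, and the tree is collapsed to it. This is
the use of joining the root to both ends. -/
theorem dist_attachTree_deleteIncidenceSet_inl (v x y : V) (hab : G.Adj a b) :
    ((attachTree G a b n p).deleteIncidenceSet (.inl v)).dist (.inl x) (.inl y) =
      (G.deleteIncidenceSet v).dist x y := by
  obtain ⟨c, hcv, hc⟩ : ∃ c, c ≠ v ∧ (c = a ∨ c = b) := by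
    by_cases hav : a = v
    · exact ⟨b, fun h => hab.ne (hav.trans h.symm), Or.inr rfl⟩
    · exact ⟨a, hav, Or.inl rfl⟩
  have key : ∀ x, x ≠ v → (x = a ∨ x = b) → x = c ∨ (G.deleteIncidenceSet v).Adj x c := by
    rintro x hxv hx
    rw [deleteIncidenceSet_adj]
    rcases hx with rfl | rfl <;> rcases hc with rfl | rfl
    · exact Or.inl rfl
    · exact Or.inr ⟨hab, hxv, hcv⟩
    · exact Or.inr ⟨hab.symm, hxv, hcv⟩
    · exact Or.inl rfl
  refine dist_eq_of_map (f := Sum.elim id fun _ => c) (f' := Sum.inl) ?_ ?_ rfl rfl rfl rfl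
  · rintro (x | i | ⟨⟩) (y | j | ⟨⟩) hxy <;> rw [deleteIncidenceSet_adj, attachTree_adj] at hxy <;>
      simp only [attachTreeAdj, Sum.elim_inl, Sum.elim_inr, id_eq, true_or, ne_eq,
        Sum.inl.injEq] at hxy ⊢
    · exact Or.inr (deleteIncidenceSet_adj.2 hxy)
    · exact key x hxy.2.1 hxy.1.1
    · exact hxy.1.elim
    · exact (key y hxy.2.2 hxy.1.1).imp Eq.symm Adj.symm
    · exact hxy.1.elim
  · intro x y h
    rw [deleteIncidenceSet_adj] at h
    exact Or.inr (deleteIncidenceSet_adj.2 ⟨h.1, by simpa using h.2.1, by simpa using h.2.2⟩)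

theorem dist_attachTree_deleteIncidenceSet_inr (hn : 0 < n) (v : V) (t t' : Fin n ⊕ Unit) :
    ((attachTree G a b n p).deleteIncidenceSet (.inl v)).dist (.inr t) (.inr t') =
      (attachTree G a b n p).dist (.inr t) (.inr t') := by
  refine dist_eq_of_map (f := id) (f' := Sum.elim (fun _ => .inr (.inl ⟨0, hn⟩)) Sum.inr)
    (fun x y h => Or.inr (deleteIncidenceSet_le _ _ h)) ?_ rfl rfl rfl rfl
  rintro (x | i | ⟨⟩) (y | j | ⟨⟩) hxy <;> rw [attachTree_adj] at hxy <;>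
    simp only [attachTreeAdj, Sum.elim_inl, Sum.elim_inr, true_or] at hxy ⊢
  · exact Or.inl (congrArg (Sum.inr ∘ Sum.inl) (Fin.ext hxy.2.symm))
  · exact Or.inl (congrArg (Sum.inr ∘ Sum.inl) (Fin.ext hxy.2))
  all_goals
    exact Or.inr (deleteIncidenceSet_adj.2 ⟨hxy, Sum.inr_ne_inl, Sum.inr_ne_inl⟩)

theorem dist_attachTree_inl_inr (hn : 0 < n) (hp : p < n) (hL : IsEdgeDepth G a b L) {w c : V}
    (hc : c = a ∨ c = b) (q : G.Walk w c) (hq : q.length = L w) (t : Fin n ⊕ Unit) :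
    (attachTree G a b n p).dist (.inl w) (.inr t) = L w + treeDepth n p t := by
  obtain ⟨r, hr⟩ := exists_walk_attachTree (p := p) hn hp hc q t
  apply le_antisymm (hq ▸ hr ▸ dist_le r)
  obtain ⟨r', hr'⟩ := r.reachable.exists_walk_length_eq_dist
  exact hr' ▸ hL.add_treeDepth_le_length r'

theorem sum_dist_sum_type {T : Type*} [Fintype V] [Fintype T] (K : SimpleGraph (V ⊕ T)) :
    ∑ x, ∑ y, K.dist x y = ∑ x, ∑ y, K.dist (.inl x) (.inl y) +
      2 * ∑ x, ∑ t, K.dist (.inl x) (.inr t) + ∑ t, ∑ t', K.dist (.inr t) (.inr t') := by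
  simp only [Fintype.sum_sum_type, Finset.sum_add_distrib]
  have h : ∑ t : T, ∑ x : V, K.dist (.inr t) (.inl x) =
      ∑ x : V, ∑ t : T, K.dist (.inl x) (.inr t) := by
    rw [Finset.sum_comm]
    simp only [dist_comm]
  rw [h]
  ring

section Sums

variable [Fintype V]

theorem sum_ite_add_sum [DecidableEq V] (f : V → ℕ) (v : V) :
    ∑ w, (if w = v then 0 else f w) + f v = ∑ w, f w := by
  rw [← Finset.sum_erase_add _ f (Finset.mem_univ v), ← Finset.filter_ne', Finset.sum_filter]
  simp [ite_not]

theorem wienerIndex_attachTree (hn : 0 < n) (hp : p < n) (hab : G.Adj a b)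
    (hL : IsEdgeDepth G a b L)
    (hwalk : ∀ w, ∃ c, (c = a ∨ c = b) ∧ ∃ q : G.Walk w c, q.length = L w) :
    2 * wienerIndex (attachTree G a b n p) = 2 * wienerIndex G +
      2 * ∑ w, ∑ t, (L w + treeDepth n p t) +
      ∑ t, ∑ t', (attachTree G a b n p).dist (.inr t) (.inr t') := by
  rw [two_mul_wienerIndex, two_mul_wienerIndex, sum_dist_sum_type]
  simp only [dist_attachTree_inl _ _ hab]
  congr 3
  refine Finset.sum_congr rfl fun w _ => Finset.sum_congr rfl fun t _ => ?_
  obtain ⟨c, hc, q, hq⟩ := hwalk w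
  exact dist_attachTree_inl_inr hn hp hL hc q hq t

theorem two_mul_wienerIndex_deleteVertex_attachTree (hn : 0 < n) (hab : G.Adj a b) (v : V) :
    2 * wienerIndex (deleteVertex (attachTree G a b n p) (.inl v)) =
      2 * wienerIndex (deleteVertex G v) +
      2 * ∑ w, ∑ t, ((attachTree G a b n p).deleteIncidenceSet (.inl v)).dist (.inl w) (.inr t) +
      ∑ t, ∑ t', (attachTree G a b n p).dist (.inr t) (.inr t') := by
  rw [two_mul_wienerIndex_deleteVertex, two_mul_wienerIndex_deleteVertex, sum_dist_sum_type]
  simp only [dist_attachTree_deleteIncidenceSet_inl _ _ _ hab,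
    dist_attachTree_deleteIncidenceSet_inr hn]

/-- Deleting a vertex of `G` that is not needed to reach the edge `ab` changes the total distance
of the graph with the attached tree as follows. -/
theorem wienerIndex_deleteVertex_attachTree (hn : 0 < n) (hp : p < n) (hab : G.Adj a b)
    (hL : IsEdgeDepth G a b L)
    (hwalk : ∀ w, ∃ c, (c = a ∨ c = b) ∧ ∃ q : G.Walk w c, q.length = L w) {v : V}
    (hv : ∀ w, w ≠ v → ∃ c, (c = a ∨ c = b) ∧ c ≠ v ∧
      ∃ q : (G.deleteIncidenceSet v).Walk w c, q.length = L w) :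
    wienerIndex (deleteVertex (attachTree G a b n p) (.inl v)) + wienerIndex G +
        ∑ t, (L v + treeDepth n p t) =
      wienerIndex (attachTree G a b n p) + wienerIndex (deleteVertex G v) := by
  classical
  have h1 := wienerIndex_attachTree hn hp hab hL hwalk
  have h2 := two_mul_wienerIndex_deleteVertex_attachTree (p := p) hn hab v
  have h3 : ∀ w, ∑ t, ((attachTree G a b n p).deleteIncidenceSet (.inl v)).dist (.inl w) (.inr t) =
      if w = v then 0 else ∑ t, (L w + treeDepth n p t) := by
    intro w
    split_ifs with hwv
    · rw [hwv]
      exact Finset.sum_eq_zero fun t _ => dist_deleteIncidenceSet_self _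
    · refine Finset.sum_congr rfl fun t _ => ?_
      obtain ⟨c, hc, hcv, q, hq⟩ := hv w hwv
      obtain ⟨r, hr⟩ := exists_walk_attachTree_deleteIncidenceSet (p := p) hn hp hc hcv q t
      apply le_antisymm (hq ▸ hr ▸ dist_le r)
      obtain ⟨r', hr'⟩ := r.reachable.exists_walk_length_eq_dist
      rw [← hr']
      have := hL.add_treeDepth_le_length (r'.mapLe (deleteIncidenceSet_le _ _))
      rwa [Walk.length_mapLe] at this
  simp only [h3] at h2
  have h4 := sum_ite_add_sum (fun w => ∑ t, (L w + treeDepth n p t)) v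
  omega

/-- Deletion can only lengthen the walks from the other vertices of `G` to the tree. Connectedness
excludes the default distance `0`, which would break the bound. -/
theorem le_wienerIndex_deleteVertex_attachTree (hn : 0 < n) (hp : p < n) (hab : G.Adj a b)
    (hL : IsEdgeDepth G a b L)
    (hwalk : ∀ w, ∃ c, (c = a ∨ c = b) ∧ ∃ q : G.Walk w c, q.length = L w) {v : V}
    (hv : (deleteVertex (attachTree G a b n p) (.inl v)).Connected) :
    wienerIndex (attachTree G a b n p) + wienerIndex (deleteVertex G v) ≤
      wienerIndex (deleteVertex (attachTree G a b n p) (.inl v)) + wienerIndex G +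
        ∑ t, (L v + treeDepth n p t) := by
  classical
  have h1 := wienerIndex_attachTree hn hp hab hL hwalk
  have h2 := two_mul_wienerIndex_deleteVertex_attachTree (p := p) hn hab v
  have h3 : ∑ w, (if w = v then 0 else ∑ t, (L w + treeDepth n p t)) ≤
      ∑ w, ∑ t,
        ((attachTree G a b n p).deleteIncidenceSet (.inl v)).dist (.inl w) (.inr t) := by
    refine Finset.sum_le_sum fun w _ => ?_
    split_ifs with hwv
    · exact Nat.zero_le _
    · refine Finset.sum_le_sum fun t _ => ?_
      have hr := (reachable_deleteVertex (G := attachTree G a b n p) (v := .inl v)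
        (x := .inl w) (y := .inr t) (by simpa using hwv) Sum.inr_ne_inl).1 (hv _ _)
      obtain ⟨r', hr'⟩ := hr.exists_walk_length_eq_dist
      rw [← hr']
      have := hL.add_treeDepth_le_length (r'.mapLe (deleteIncidenceSet_le _ _))
      rwa [Walk.length_mapLe] at this
  have h4 := sum_ite_add_sum (fun w => ∑ t, (L w + treeDepth n p t)) v
  omega

end Sums

theorem connected_attachTree (hn : 0 < n) (hp : p < n) (hG : G.Connected) :
    (attachTree G a b n p).Connected := by
  have h : ∀ x, (attachTree G a b n p).Reachable (.inl a) x := by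
    obtain ⟨r, -⟩ := exists_walk_attachTree (G := G) (b := b) hn hp (Or.inl rfl)
      (Walk.nil : G.Walk a a) (.inr ())
    rintro (x | t)
    · exact reachable_map (G' := attachTree G a b n p) (f := Sum.inl) (fun _ _ h => Or.inr h)
        (hG a x)
    · exact (exists_walk_attachTree (G := G) (b := b) hn hp (Or.inl rfl)
        (Walk.nil : G.Walk a a) t).choose.reachable
  have : Nonempty (V ⊕ Fin n ⊕ Unit) := ⟨.inl a⟩
  exact ⟨fun x y => (h x).symm.trans (h y)⟩

theorem connected_deleteVertex_attachTree (hn : 0 < n) (hp : p < n) {v : V}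
    (hv : ∀ w, w ≠ v → ∃ c, (c = a ∨ c = b) ∧ c ≠ v ∧ (G.deleteIncidenceSet v).Reachable w c)
    (hG : ∀ x y, x ≠ v → y ≠ v → (G.deleteIncidenceSet v).Reachable x y) (hab : a ≠ b) :
    (deleteVertex (attachTree G a b n p) (.inl v)).Connected := by
  obtain ⟨w, hwv⟩ : ∃ w, w ≠ v := by
    by_cases hav : a = v
    · exact ⟨b, fun h => hab (hav.trans h.symm)⟩
    · exact ⟨a, hav⟩
  obtain ⟨c, hc, hcv, -⟩ := hv w hwv
  have h : ∀ x : V ⊕ Fin n ⊕ Unit, x ≠ .inl v →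
      ((attachTree G a b n p).deleteIncidenceSet (.inl v)).Reachable (.inl c) x := by
    rintro (x | t) hx
    · refine reachable_map (f := Sum.inl) (fun x y h => Or.inr ?_) (hG c x hcv (by simpa using hx))
      rw [deleteIncidenceSet_adj] at h ⊢
      exact ⟨h.1, by simpa using h.2.1, by simpa using h.2.2⟩
    · exact (exists_walk_attachTree_deleteIncidenceSet hn hp hc hcv Walk.nil t).choose.reachable
  have : Nonempty ↥({.inl v}ᶜ : Set (V ⊕ Fin n ⊕ Unit)) := ⟨⟨.inl c, by simpa using hcv⟩⟩
  exact ⟨fun x y => (reachable_deleteVertex x.2 y.2).2 ((h x x.2).symm.trans (h y y.2))⟩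

/-- An inner vertex of the attached path is a cut vertex. -/
theorem not_connected_deleteVertex_attachTree {i : Fin n} (hi : i.val + 1 < n) :
    ¬ (deleteVertex (attachTree G a b n p) (.inr (.inl i))).Connected := by
  intro h
  have hr := (reachable_deleteVertex (G := attachTree G a b n p) (v := .inr (.inl i))
    (x := .inl a) (y := .inr (.inl ⟨i + 1, hi⟩)) Sum.inl_ne_inr (by simp [Fin.ext_iff])).1 (h _ _)
  -- The vertices on the same side of the deleted vertex as `G` are closed under adjacency; the
  -- pendent vertex belongs to them exactly when `p < i`.
  have := of_reachable (P := fun x : V ⊕ Fin n ⊕ Unit => match x with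
    | .inl _ => True
    | .inr (.inl j) => j.val < i.val
    | .inr (.inr _) => p < i.val) ?_ hr trivial
  · simp at this
  · rintro (x | j | ⟨⟩) (y | l | ⟨⟩) hxy hx <;>
      rw [deleteIncidenceSet_adj, attachTree_adj] at hxy <;>
      simp only [attachTreeAdj, ne_eq, Sum.inr.injEq, Sum.inl.injEq, Fin.ext_iff,
        not_false_eq_true, and_true, true_and, reduceCtorEq] at hxy hx ⊢
    all_goals omega

theorem wienerIndex_deleteVertex_attachTree_last [Finite V]
    (hQ : (attachTree G a b n p).Connected) {i : Fin n} (hi : 0 < i.val) (hin : i.val + 1 = n)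
    (hip : p ≠ i.val) : wienerIndex (deleteVertex (attachTree G a b n p) (.inr (.inl i))) <
      wienerIndex (attachTree G a b n p) := by
  have := Fintype.ofFinite V
  refine wienerIndex_deleteVertex_lt_of_leaf hQ (u := .inr (.inl ⟨i - 1, by omega⟩)) ?_ ?_
  · rw [attachTree_adj]
    simp only [attachTreeAdj]
    omega
  · rintro (y | l | ⟨⟩) h <;> rw [attachTree_adj] at h <;> simp only [attachTreeAdj] at h
    · omega
    · have := l.2
      refine congrArg (Sum.inr ∘ Sum.inl) (Fin.ext ?_)
      change l.val = i.val - 1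
      omega
    · omega

theorem wienerIndex_deleteVertex_attachTree_pendent [Finite V]
    (hQ : (attachTree G a b n p).Connected) (hp : p < n) :
    wienerIndex (deleteVertex (attachTree G a b n p) (.inr (.inr ()))) <
      wienerIndex (attachTree G a b n p) := by
  have := Fintype.ofFinite V
  refine wienerIndex_deleteVertex_lt_of_leaf hQ (u := .inr (.inl ⟨p, hp⟩)) rfl ?_
  rintro (y | l | ⟨⟩) h <;> rw [attachTree_adj] at h <;> simp only [attachTreeAdj] at h
  exact congrArg (Sum.inr ∘ Sum.inl) (Fin.ext h)

end AttachTree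

/-! ### Existence of a quartic Moore graph of girth 12 -/

section Hexagon

/-- A packed table of the neighbours of the `728` points and lines of the split Cayley hexagon of
order `3`. -/
def hexagonTable : ℕ :=
  0x8d914540dd37185661b144d415b1d678911af9ad775e900897a916a369a25b66e520ce0207c67df37f9512b1971920160dc640d2c9258d5352ab2de14a6cc781d386874001a8765e8148018d9355e1bc398c3895ef6cc05309586b8aa57a814223f285820362c175de7c4866fd1b469622153a12a3a502026114f3be123b593686d400e165945815cb802a7788c040f19b7f1bd7f8f6269ed616342d6097ac985b8093d11945c0795851212578a5204eda7240e76c8d21f6955368a820d9524cf4fa086e2678a08d9444506e845edc0388651829f8ac339ec3209aa6042761cc8e5c4545f48d6d8fc1bcb63ed222ad590da8f79902434daab1e5658bd5764a570bcb4a0e490061024d5567f0b00b8c0c56fd92645724d962ab63f64ca96ac7650664731aa1d48c0512d38574a000c37c6e87a529d06457c63a0a5b58cbb5f921a19ee1b1f92927d179f2910629f6b3991cb4454b509cb738ff8e61539d73850172dc961ee1b04e5f33427a9e2012cb15f1392c1b9075382d9d897132489315e9d211eb20965e3024c1b4200f5301b1c2744e832491a5cb512cf418da59a0d6abda4354aa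394595a24024d1e84299912c5474920bceaa6c0f5981107ea25edf73dd4c83a9620e957551f9d4ee40eac5a45a265ec62c6b61a0b628cb55d333c00e2e6bc2b819aac242bc87129e39f2485ae9a9208c48d5b49da46b050882617aa3f894b25911c5a1e51fc4697654952d191c4962d98685924a58a6423463981411e54858783200085d7304e98ca852801c0deb0398c20dcfa704893cce866a2aa7a94068341402d8dcf2640db275619c88c2157439533968652129029d606128a109289bd1f105271f28c075205161e22e998ca279803b771ba07872630719403a1c0e4ad647ad82205925441b74e5799be6e361d3731d6531e14ace58469a6b07733aaf9604f2514776c9f51977054be67975a8d160488f22067a24431e9c7675530da1168ea587c35842cd6c2749d46b9ba571aa24744bc8c15369c555c952a55c422a81580e93b1c37986d5a62f38e087ada987ca517e8320ac4a7e71571ed545477f1463b55973d43715a46653158c3e40435b01f90a29225d5e320697e82898c681305bb5ec84bc647c0c1585549b2b91201214d707fc3b33cf896a681e1a652d1291aa106461909b92ac6b21a2747d75658e0668ce204c3b0d210c15dab4ec0505d57e65ad50578cb467eb00b1b48ba5a86c2b1582a7ee19156c79c4b32e51633e474302baec185389c365e76f8fa361f89c937a3d0444249901e22d69a6be5b6e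91e2b1ac63114475aba4227284c6668253aeca41e2622cc4418cc4d217768950a61806abd2e954560515be92a44e02b43180d155585c75427792bf9484f6264a13a07a0a49455f76d892a927d5fcb32dda57d9281b92e9a9199e518134f16a95a72d6728909792b8ac6b22a2412bca18415441dbd7811b469064a9bc721806ed603cc2e84d232a1d0b01876e2ce4fc490e07468a6a0e09c1363312acf3c6ba25916699afae80c8f48077e262e9536d4660ae38a5e3a5093c4345b652219f8242060f8344f70491575ee371da40dd84614f186d039c9808d1e2ee9600ec212d1c78c4503a35342c768d007d69707dde63eb98f803139cd0fe7aae2410f88a508df9c48f166d32348008ec93503b2a622654c89090ea9d43a9a709acd784a09689918a4e69d5f087d5c602d494ecc685c568a06b2cff7ece45a4dd26deeb0c7d760f9b4c333d4d1964b42fc396724f7d4b954a17b257a0c926a31f40f1dd462693784494ed56581c9f2127283a5c470379b79511d4f6cb1ec09a2da31fe46a1c806adb58088e8f0b9384f14bce0a4c697b18a6812694e9d34c7ea4e9443a0a7557a2207d34578389ad811766953d5924b0fd3263c82b39738f066161e1910ae4106e1bd7c90c3a0e466a20780e2667d8160dc06ab95b2fec20daa15acdf1ce218194a006ba01ec829a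052fe0455c8f4561d9648f07e8d1322f618fdac2017525535443aa4a529a0f36dd022dfa61113672282d875b184839090acc1838ed6004855e43992033878150c9fd512c53315fb50cb7255e9467205a1da78067421ca742e1aa0a45d862ea411b04129aca350d3916b44e23120dfda160d720d79cd0fa123c929ef7495eb49e0792009b581af9e173528540b331c5e8a2d093976400a392d2e55868665db2bdb4116bb59d3686a2d994528ed9c5487953e6db5813b3c00568658b42a75aa54acc02b9e724d302b5f83f8e4a7ebe002a14fe6d282a07900598a6c180612e1ed5c1c62c12f2be6b46c29b356f961463ae1c28e6d42a7a7366c9e5371a2114d85e28d6a4d4b13f93480a6a6e2791c5a94bad618eb9afe5e6d0aa18ace529320891db105414c406866b8104c149e250c8783851a602a1513a14eaa2742903e8e0a1c39f827ab89572a8b161d945c576c255b210b011c915a4f59d737219e2e8951b8de8ba4ea702c19e61718caa497729ea0914314250baa9d463e332d112855415598d264e8adc340446fb44b3b54042acb26fa74094296209fb492077e429ec0f9c2832c82166d26829772827f315230c10baf450555c73ae708ed0c42a980d4bea82c1988624b6358110f90e5fa662a481ae8e6c568dad7d4da8aea5a913e8f9e29cdc02404e828ec22997292a81223d1190ab1a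156ed099e07e84d9d2216f3dc7ba89641d21681e357ee464f24b6649e915da036cf8f913b5c8668002079f4662bf888873b8f247accac8ca94e7e4040211e94206316f5244c183ac52f220894bad10e4e28f9063e650630f88f64f3dc461365b2247e3d9ae3d5e65fe3c7aa93251f9b569e2116f3cd0bb00833aa013c992ac55c0f42f7203c19dd354df90ecaa0783d3eeb40297e076c1954720728e1c68d6981b2118a1b220a81891019b622c83500b8607261d269e0ad9805171e8c279838ecd6a2c446510052a8863a36525ce6159d5220c2529c09961b349102c8a07a52069951eacc39a053966cb2c79835a002a5e9cce3974177353459dd99589a404e91b6a35284259a7380cf9aa28b3c049a622c43e6aad56a57e5c8ba7c4465d53682875f2609d3872817c46a2ee70b081b8198d0d20534ac117cd3ade0c82df4381d7ad979175a9891fd934976e8fd84e0f022d73721cb5415545b42f57019e312791fa52d40221f33655191a448560799cb18c8da98347e0d53362358cf65c578501652516362d585c60955c3f1a0b1b10f1344c781a1951e0531a188a45f314699ae20311c49edf430ecda9cd4360c1494c08e94c4c19e0b9ef15e937802d64c2c2b587369b84542baa4153242d4eea80501015a6604e2148d47311dd8c94630c509f9555142f43144046ba770be3ad43a183cadc8780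e6550079538cc98d3f4220b7f9cf11d229e0c401c6a36ebf5382a9f0122d45cafa3d0415a8ae43869643d58ca00b71d93f494c79a6435b8829968735eb47ce9278d2ab1e674a6529828377e5764db249cb2905b109948ab9c9288a5a71cf8522d461ce1f1ea6fa9b751d75d4ca77ed72b0057d514b580e3be626d44c574fdb4aa629eb209a220350295221129a539de5a1531298a9434486de8469d357a1021c5a7731192fd1a136b37709b41dc92c0a2269ef8cab1266249462db449843110a3c96086183c9ae082791cdad5341f379733f28703820036380fde767d07264e986d061b49859905a84223c0f94121940cf8b1e2c2bac614a679a45c40a354049fa25956eddb6fcd2938603d5624484e032a5a924623044a611c7c820859767eda973dda9de2463ebc2385a26e0da44eaaa68c2a1b3a1a1e3b6b8771708a43e5b5a08960e38d685b27111d086228e6387fa34d063a0767276309959ddc4850fe4cd94b3c093761d0e2a85b22f612c54f2843581ba7de780836820b65c8d997c806d9bc6a0d6158e16da4056495a58696219e62c7782476340e181e1bb1075599919a0733016a05e4f0591154932988095f4170202e7fe22344752dddeae4d0494185b8cf31e7a338c6ae1f38e47445ad3336911e9fd292175d97b5092d42a50a09940643a1ac3183e81a1c667d92c56c2d6cab4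6e9ea6ee4daacb874077ac2aa439e99d0bca76616d4558665b9115a4b1eb52666510605264c7295653a763d17f8bac254014986c16c4284dd41ad65f9f5406981309e3f3a1c68b1f752c61745fc29de92c1d19bc72169cc51157165caacdde970dfb405815d55a41d20412a92c963cd296640f016317082128c599448e28a9e08cea26e9d285b38015425eca281beaaccb1fe594d1399618634d380904f95dd414d6daa5c3a6d75831c490924a24c6a5d37a21a88be489e8923bdaa472472910573a384218967637931124f574715c2245fa9801dab9978dace43e9aa150e6169960c1c58695640818c1f3ab4be64089416401091967d891069645c40b0e2a3b613028c17e2370f8029ecb81047e1de831f5e91f17aaf5c51ed79af0ff3ea26295779148b894430f6aa5f9821bd7d8cd81602c9668c2ad9335fe159c9653e2631c2117da502f5ec8415b5160b7fcd2601b936e370ddf1a1a8e9d6c07f8d7488359ba016cd598d0d5a28b13c14b9bd450c1580beaf7c19b4c4062f1d70024c155b70c12417e5e1685e975a817536a8d8171d097b0c88ecb416deb4ec54a213e760f44f6bb7a25a4f23324dd5961c36c1db521c27fcab706009984b70267a9ca86fe4a8e962126494351a5ba646c023ab5dd089d9ab1af8517200c9211a2b10965a00454f8f7271aa4020398cfc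240ff3fa28a89743f62788dfa65a265f8ee5ad7d85d8d8e57c8e0855ec82a3e12ab12d364e28696ba28189d8707dc011d9e80cdf295832315829a4cc5a078324bba24cb7b9b99fcca4ed4f9652b9728d4e86518a684e5d62a53846eaf4ae160466424c048c27726a23095b2a449f275279589e705ac938fc44daf3ec86a722aa40fa660838d0ee02e4d5b67f068f63eeab1e8eca017c5a479370c99e1f0362c3544c801dfc2f69b4d52ca8812af05c4e928276b72b1d24509c442d03beb6031bc6adc0a8c44b1991374785e2bb5b0197c5edaf431b4c5b5414c6f424b25b110d9265eca

/-- A packed table of an automorphism of order `3` of the incidence graph of the hexagon. -/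
def hexagonRotationTable : ℕ :=
  0xb5ecfb36d2b42ccb12c6b0aceafed4afabdb2ac8b16d3ad6b3abed6abaa7b56a4b26a3a8aa1aea9da72bbb1ea9b4694a4e92a428ea5a8aa26b4aaa87a16b2a0acba02b6ae67e9f67ba0e789de9a9d6739ca6f9baa69ae8caaec39a2c199ab099664a466398a61b025fae27c95ebc95a55952a597a5093eb79364c92a5290e5a91241ab63f8fa3dac63c8ee3a8e6388d6ac8cea8982868b29e8ae679229793a2689623a829f87e1e86e1992e17a6e149e69984a119c66c83e47a620d82a09a560691a0480e8f9728d7fe36a2dfca21f97e2347d9f581e847c9f07be157b9eca05ea9fe3179e32792748b9df77a169e9dc965d97627675dd696dd5751d3741cf76e70731cb72a6d7266a9a5e6719c5709bf6fa30735b9882226ddb5875b46ce5d6c5d26b9ac6f6586a9c47cda8699a58225368da2789a16825167d9e675ba86a286664965a4564e2a642426ed8e632407962d6218761983602245fa377e97c615956497883175705735c9718bd6f7a56d65d895ae295aa275a56859d656da218096057de15721c5621882d565555484d517c6107f54e839ed531595294953dfb51d465160550d777f941805b24fa004f55b4ed3a4e59a4d93571d34769334c9f769d307d12d6092c4ad2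a4a1eb591257a1a948d7b4892178d20479e070d1c745dd4651845d7a6291546d1444d12445104353f7390841d536c1057210440d0263cff3f9373f1c0588fa3e0f76f0f53d1b83ccf24bcf13c0ef6bdad3b5ab3b0eb430ea3a4e8690e65751f390e3660e23859c66cdf378dd635943699143cd736566350f934cd262cd1340cf610d6334cc6057f3297d324c831d3c5e4c55d974305702fd6e5b0bd2f0bb2e8b858d612d95e2d4b3568b155caf2b952540ac2ad4d52ca92a14029ca62954828d44508a1280b427c9e275384289b268992a8974c4964b89524d2949d2623d242388d231004748a468892211621c862448420d0e2050b4247f4187e1f5011e8fd3ec781dcf6250751f0731c8c43b87036c6f1b86d39ce51ac6a1a4e019cdc194c336062354611805f338c2174cb1705b3185a16458300be15855150b92dc5013cb22c04d2b44c12c6412849120a4288461144427042260521003f248900f4740f03b22c3a0e43821436208800d0331ec790c4760c02f1c42e0b42c1b02a1a0660a06309c26178250902315c2114c5107c4e0781d0704706843104180f817058150dc3504c32048110402b0a40e0340c088200280906c1901c06050050100f0080b0040800003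

/-- A packed table of an automorphism of order `2` of the incidence graph of the hexagon. -/
def hexagonPolarityTable : ℕ :=
  0xb3ed5b5acbb2ac5b36c3b5ec0b46beb52d3aeebaae2b7b4ab1b42aeaa2cea96cca8eabb26c8a7ac7b1a9ba6698a5a9fb1297ab2c2a2aafaf288a1ec1a3e84afe81af67f9fa8bacab99ea8dada75ad6b4ac2b39f66c9e66a9a668a9e66a7265a82ad98eaaaa66797ea697657a9256a8aa1a56529469da4e4e9da77a6a489c242906739024994e948f292a4690a1a8ea3234a26318be2ea162ba0e2a8a62789a50a0a808861f9b67c9ee588627885a3784e129ba748420f8ee0e836729c66f8221c8166b91601801ff931fe7f6647ea1b989f7986607d1f397a5c96dee96a597ae077a1e7955e6951e377e3e8c9dd7724f76e4d831d792e4a7564791a4490e15739cd7be3f891c98f5c871dc68ea398e2368d5bc6ea336e1b78c1c36d22d8b1b2701af826286adaa895a96a22388a20691a3879d3685ad8759f86a1985d9c66d9a8519884594789916d98f63a0b8298b6298981a0480e026057f7d97d5f1f15ed795e1fc5d9fb5d1f97e1d15c1f55b9f25b16b7c16a781697b5ec7a9e958d61581e57915e7855a77957559da765d8549d65414f539d4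5354c7494b741cf52147731cb729445cd425055d5013e7153d7113b709c16fd366f9bd4d1bb4cdb961d314c1b54b9b34b1b16c1ae6b127499554912369d22699a5481a26111d471a0469196799d5991645599451976599564d926410b4218d6310641588411866158340582600fd5f8fb3e92d4397a3d9775d4f35c9713c56f4e16d3b8ed444ec5a1673a9655916239d5f394e45715b38959560e037d5454d51370db4a4d835d37354d4528d3401493454651543338cd4fd0932cca4f0c94e9393acc631535310c24c8c04bcbe2f52b4a9283e5252dcb6484b547d1e2c91b2c11845cad2b113448aa2a51043ca74350c428a441ca2285034089f3fcfe3f09c26cf83dcf5260f4258f2254f03bc922408f2bc8e3a4e83988b228e3224e12e487378dd214da36482358801fcd21f8d033c7b330791e0c831c761d4c31d0c12fc711c0bc1bcbb2e8b81b06b2d0b32c4682b8652ac63188a8184a6294a31785d2805c2789d1689a2649715c5625093244511408d2304e13488130532184a21083204471187d1f07a10c77104401cc720f83d1983c1b86d0e86a1a4670dc640d4341805f0c83116c30164580b855150520ac4f0a42812c271244809445110420883f0801f0ec1e0e4380d81b0cc190602f05c2d0b02a0501309812090230840f0381d0701a02c0a0581502007044100140d03003024010180001002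

/-- A packed table of the distances from the vertex `0` in the incidence graph of the hexagon. -/
def hexagonDepthTable : ℕ :=
  0x54554566245561554666545554566465566565555356555655666625655556564555555565456434655456545566546556556645552654666646465365444465553655666652656664344556546666465645655366464556553555655545624564665665555553664656663353556555666556555555455666656645565555665653555556664455555555543554555424455555656564624665643555565353155651656664355555565545656645465654644556564666446456556555525564535436446666455556566626466445466646555664665655655555556656665466446465465455564666566656556665465346655333556546646564455665543555666554555565355554455555654666456556535555535645555556555636555656666633535565565665556566546265646643555636256646546664665626545556666444566616356555566454556555555566555535545465356544665646645646554555556560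

/-- The `k`-th neighbour, `k < 4`, of the vertex `x`. -/
def hexagonNbr (x k : ℕ) : ℕ := hexagonTable / 1024 ^ (4 * x + k) % 1024

/-- The automorphism of order `3` in the table. -/
def hexagonRotation (x : ℕ) : ℕ := hexagonRotationTable / 1024 ^ x % 1024

/-- The automorphism of order `2` in the table. -/
def hexagonPolarity (x : ℕ) : ℕ := hexagonPolarityTable / 1024 ^ x % 1024

/-- The distance from `0` to `x`. -/
def hexagonDepth (x : ℕ) : ℕ := hexagonDepthTable / 16 ^ x % 16

theorem hexagonNbr_lt : ∀ x < 728, ∀ k < 4, hexagonNbr x k < 728 := by decide +kernel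

theorem hexagonNbr_symm :
    ∀ x < 728, ∀ k < 4, ∃ j < 4, hexagonNbr (hexagonNbr x k) j = x := by decide +kernel

theorem hexagonNbr_ne : ∀ x < 728, ∀ k < 4, hexagonNbr x k ≠ x := by decide +kernel

theorem hexagonNbr_injOn :
    ∀ x < 728, ∀ k < 4, ∀ j < k, hexagonNbr x k ≠ hexagonNbr x j := by decide +kernel

theorem hexagonRotation_lt : ∀ x < 728, hexagonRotation x < 728 := by decide +kernel

theorem hexagonPolarity_lt : ∀ x < 728, hexagonPolarity x < 728 := by decide +kernel

theorem hexagonRotation_cube :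
    ∀ x < 728, hexagonRotation (hexagonRotation (hexagonRotation x)) = x := by decide +kernel

theorem hexagonPolarity_sq :
    ∀ x < 728, hexagonPolarity (hexagonPolarity x) = x := by decide +kernel

theorem hexagonRotation_nbr : ∀ x < 728, ∀ k < 4,
    ∃ j < 4, hexagonNbr (hexagonRotation x) j = hexagonRotation (hexagonNbr x k) := by
  decide +kernel

theorem hexagonPolarity_nbr : ∀ x < 728, ∀ k < 4,
    ∃ j < 4, hexagonNbr (hexagonPolarity x) j = hexagonPolarity (hexagonNbr x k) := by
  decide +kernel

/-- Repeated descent carries any vertex to `0` by automorphisms, so short cycles need only be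
excluded through `0`. -/
theorem hexagon_descent :
    ∀ x < 728, x ≠ 0 → hexagonRotation x < x ∨ hexagonPolarity x < x := by decide +kernel

theorem hexagonDepth_nbr :
    ∀ x < 728, ∀ k < 4, hexagonDepth (hexagonNbr x k) ≤ hexagonDepth x + 1 := by decide +kernel

theorem hexagonDepth_zero : hexagonDepth 0 = 0 := by decide +kernel

theorem hexagonDepth_pos : ∀ x < 728, x ≠ 0 → 0 < hexagonDepth x := by decide +kernel

theorem hexagonDepth_parent : ∀ x < 728, hexagonDepth x = 0 ∨ 5 < hexagonDepth x ∨
    ∀ k < 4, ∀ j < k, hexagonDepth x < hexagonDepth (hexagonNbr x k) ∨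
      hexagonDepth x < hexagonDepth (hexagonNbr x j) := by decide +kernel

/-- The incidence graph of the split Cayley hexagon of order `3`. -/
def hexagonGraph : SimpleGraph (Fin 728) where
  Adj x y := ∃ k < 4, hexagonNbr x k = y
  symm := ⟨fun x y h => by
    obtain ⟨k, hk, h⟩ := h
    rw [← h]
    exact hexagonNbr_symm x x.2 k hk⟩
  loopless := ⟨fun x h => by
    obtain ⟨k, hk, h⟩ := h
    exact hexagonNbr_ne x x.2 k hk h⟩

instance : DecidableRel hexagonGraph.Adj :=
  fun x y => inferInstanceAs (Decidable (∃ k < 4, hexagonNbr x k = y))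

theorem hexagonGraph_adj {x y : Fin 728} :
    hexagonGraph.Adj x y ↔ ∃ k < 4, hexagonNbr x k = y := Iff.rfl

theorem hexagonGraph_regular : hexagonGraph.IsRegularOfDegree 4 := by
  intro x
  have h : hexagonGraph.neighborFinset x = (Finset.univ : Finset (Fin 4)).image
      fun k => ⟨hexagonNbr x k, hexagonNbr_lt x x.2 k k.2⟩ := by
    ext y
    simp only [mem_neighborFinset, hexagonGraph_adj, Finset.mem_image, Finset.mem_univ, true_and]
    constructor
    · rintro ⟨k, hk, h⟩
      exact ⟨⟨k, hk⟩, Fin.ext h⟩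
    · rintro ⟨k, h⟩
      exact ⟨k, k.2, congrArg Fin.val h⟩
  rw [← card_neighborFinset_eq_degree, h, Finset.card_image_of_injective, Finset.card_univ,
    Fintype.card_fin]
  intro k j hkj
  have hkj : hexagonNbr x k = hexagonNbr x j := congrArg Fin.val hkj
  rcases lt_trichotomy j k with h | h | h
  · exact absurd hkj (hexagonNbr_injOn x x.2 k k.2 j h)
  · exact h.symm
  · exact absurd hkj.symm (hexagonNbr_injOn x x.2 j j.2 k h)

/-- The automorphism of order `3` as a graph homomorphism. -/
def hexagonRotationHom : hexagonGraph →g hexagonGraph where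
  toFun x := ⟨hexagonRotation x, hexagonRotation_lt x x.2⟩
  map_rel' {x y} h := by
    obtain ⟨k, hk, h⟩ := h
    obtain ⟨j, hj, h'⟩ := hexagonRotation_nbr x x.2 k hk
    exact ⟨j, hj, h'.trans (congrArg _ h)⟩

/-- The automorphism of order `2` as a graph homomorphism. -/
def hexagonPolarityHom : hexagonGraph →g hexagonGraph where
  toFun x := ⟨hexagonPolarity x, hexagonPolarity_lt x x.2⟩
  map_rel' {x y} h := by
    obtain ⟨k, hk, h⟩ := h
    obtain ⟨j, hj, h'⟩ := hexagonPolarity_nbr x x.2 k hk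
    exact ⟨j, hj, h'.trans (congrArg _ h)⟩

theorem hexagonRotationHom_injective : Function.Injective hexagonRotationHom := by
  intro x y h
  have h : hexagonRotation x = hexagonRotation y := congrArg Fin.val h
  rw [Fin.ext_iff, ← hexagonRotation_cube x x.2, h, hexagonRotation_cube y y.2]

theorem hexagonPolarityHom_injective : Function.Injective hexagonPolarityHom := by
  intro x y h
  have h : hexagonPolarity x = hexagonPolarity y := congrArg Fin.val h
  rw [Fin.ext_iff, ← hexagonPolarity_sq x x.2, h, hexagonPolarity_sq y y.2]

theorem hexagonDepth_le_of_walk {x y : Fin 728} (p : hexagonGraph.Walk x y) :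
    hexagonDepth y ≤ hexagonDepth x + p.length := by
  induction p with
  | nil => simp
  | @cons u _ _ h p ih =>
    rw [Walk.length_cons]
    obtain ⟨k, hk, h⟩ := h
    have := hexagonDepth_nbr u u.2 k hk
    rw [h] at this
    omega

/-- A vertex of maximal depth on the cycle has two distinct neighbours no deeper than itself,
contrary to `hexagonDepth_parent`. That the table gives true distances is never needed. -/
theorem hexagonGraph_length_of_isCycle_zero {c : hexagonGraph.Walk 0 0} (hc : c.IsCycle) :
    12 ≤ c.length := by
  by_contra! hlt
  have hlen := hc.three_le_length
  obtain ⟨i, hi, hmax⟩ := Finset.exists_max_image (Finset.range (c.length + 1))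
    (fun i => hexagonDepth (c.getVert i)) ⟨0, by simp⟩
  rw [Finset.mem_range] at hi
  have hpos : 0 < hexagonDepth (c.getVert i) := by
    have h1 := hmax 1 (Finset.mem_range.2 (by omega))
    have h2 := hexagonDepth_pos (c.getVert 1) (Fin.is_lt _) (by
      intro h
      have hadj := c.adj_getVert_succ (i := 0) (by omega)
      rw [Walk.getVert_zero] at hadj
      exact hadj.ne (Fin.ext h.symm))
    omega
  have hi0 : i ≠ 0 := by
    rintro rfl
    rw [Walk.getVert_zero] at hpos
    exact absurd hexagonDepth_zero hpos.ne'
  have hi1 : i ≠ c.length := by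
    rintro rfl
    rw [Walk.getVert_length] at hpos
    exact absurd hexagonDepth_zero hpos.ne'
  -- The two arcs of the cycle back to `0` have total length at most `11`, so one has length at most
  -- `5`.
  have hle : hexagonDepth (c.getVert i) ≤ 5 := by
    have h1 := hexagonDepth_le_of_walk (c.take i)
    have h2 := hexagonDepth_le_of_walk (c.drop i).reverse
    have h0 : hexagonDepth ((0 : Fin 728) : ℕ) = 0 := hexagonDepth_zero
    rw [Walk.take_length] at h1
    rw [Walk.length_reverse, Walk.drop_length] at h2
    omega
  have hne := hc.getVert_sub_one_ne_getVert_add_one (i := i) (by omega)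
  obtain ⟨k, hk, hk'⟩ : hexagonGraph.Adj (c.getVert i) (c.getVert (i + 1)) :=
    c.adj_getVert_succ (by omega)
  obtain ⟨j, hj, hj'⟩ : hexagonGraph.Adj (c.getVert i) (c.getVert (i - 1)) := by
    have := c.adj_getVert_succ (i := i - 1) (by omega)
    rw [Nat.sub_add_cancel (by omega)] at this
    exact this.symm
  have h1 := hmax (i + 1) (Finset.mem_range.2 (by omega))
  have h2 := hmax (i - 1) (Finset.mem_range.2 (by omega))
  rw [← hk'] at h1
  rw [← hj'] at h2
  have hpar : ∀ k < 4, ∀ j < k, _ :=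
    ((hexagonDepth_parent (c.getVert i) (Fin.is_lt _)).resolve_left hpos.ne').resolve_left
      hle.not_gt
  rcases lt_trichotomy j k with h | h | h
  · have := hpar k hk j h
    omega
  · exact hne (Fin.ext (by rw [← hj', ← hk', h]))
  · have := hpar j hj k h
    omega

theorem hexagonGraph_length_of_isCycle (x : Fin 728) :
    ∀ c : hexagonGraph.Walk x x, c.IsCycle → 12 ≤ c.length := by
  induction x using WellFoundedLT.induction with
  | ind x ih =>
    intro c hc
    rcases eq_or_ne x 0 with rfl | hx
    · exact hexagonGraph_length_of_isCycle_zero hc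
    rcases hexagon_descent x x.2 (fun h => hx (Fin.ext h)) with h | h
    · simpa using ih (hexagonRotationHom x) h (c.map hexagonRotationHom)
        (hc.map hexagonRotationHom_injective)
    · simpa using ih (hexagonPolarityHom x) h (c.map hexagonPolarityHom)
        (hc.map hexagonPolarityHom_injective)

theorem hexagonGraph_exists_isCycle :
    ∃ c : hexagonGraph.Walk 0 0, c.IsCycle ∧ c.length = 12 := by
  refine ⟨.cons (by decide +kernel : hexagonGraph.Adj 0 402) <|
      .cons (by decide +kernel : hexagonGraph.Adj 402 621) <|
      .cons (by decide +kernel : hexagonGraph.Adj 621 408) <|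
      .cons (by decide +kernel : hexagonGraph.Adj 408 726) <|
      .cons (by decide +kernel : hexagonGraph.Adj 726 433) <|
      .cons (by decide +kernel : hexagonGraph.Adj 433 1) <|
      .cons (by decide +kernel : hexagonGraph.Adj 1 713) <|
      .cons (by decide +kernel : hexagonGraph.Adj 713 82) <|
      .cons (by decide +kernel : hexagonGraph.Adj 82 410) <|
      .cons (by decide +kernel : hexagonGraph.Adj 410 538) <|
      .cons (by decide +kernel : hexagonGraph.Adj 538 714) <|
      .cons (by decide +kernel : hexagonGraph.Adj 714 0) <|
      Walk.nil, ?_, rfl⟩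
  rw [Walk.isCycle_iff_isPath_tail_and_le_length, Walk.isPath_def]
  simp only [Walk.tail_cons, Walk.length_cons]
  decide

theorem hexagonGraph_girth : hexagonGraph.girth = 12 := by
  obtain ⟨c, hc, hlen⟩ := hexagonGraph_exists_isCycle
  apply le_antisymm (hlen ▸ girth_le_length hc)
  obtain ⟨x, w, hw, h⟩ := exists_girth_eq_length.2 (fun h => h c hc)
  exact h ▸ hexagonGraph_length_of_isCycle x w hw

/-- The incidence graph of the split Cayley hexagon of order `3` is a `4`-regular Moore graph of
girth `12`. -/
theorem isMooreGraph_hexagonGraph : IsMooreGraph hexagonGraph 4 6 where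
  regular := hexagonGraph_regular
  girth_eq := hexagonGraph_girth
  card_eq := by simp [Finset.sum_range_succ]

end Hexagon

/-! ### The numerical balance for degree 4 and girth 12 -/

section Quartic

variable {V : Type*} {M : SimpleGraph V}

/-- The distance of an arc from the two orientations of the edge of the arc `e`. -/
noncomputable def arcDepth (e a : M.Dart) : ℕ :=
  min (arcLevel M 5 e a) (23 - arcLevel M 5 e a)

theorem arcDepth_le (e a : M.Dart) :
    arcDepth e a ≤ 11 := by
  rw [arcDepth]
  omega

variable [Fintype V] [DecidableRel M.Adj]

theorem IsMooreGraph.card_dart (hM : IsMooreGraph M 4 6) : Nat.card M.Dart = 2912 := by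
  rw [Nat.card_eq_fintype_card, card_dart_of_isRegularOfDegree hM.regular, hM.card_eq]
  rfl

variable [DecidableEq V]

theorem IsMooreGraph.isCyclicLevel_twelve (hM : IsMooreGraph M 4 6) (e : M.Dart) :
    IsCyclicLevel (arcGraph M) 12 e (arcLevel M 5 e) :=
  hM.isCyclicLevel_arcLevel (k := 5) (by norm_num) (by norm_num) e

theorem IsMooreGraph.sum_arcLevel (hM : IsMooreGraph M 4 6) (e : M.Dart) (F : ℕ → ℕ) :
    ∑ a, F (arcLevel M 5 e a) = ∑ n ∈ Finset.range 24, arcLevelCard 4 5 n * F n :=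
  sum_comp_level (hM.isCyclicLevel_twelve e).lt
    (fun _ hn => hM.card_arcLevel_eq (k := 5) (by norm_num) e hn) F

theorem IsMooreGraph.connected_arcGraph (hM : IsMooreGraph M 4 6) (e : M.Dart) :
    (arcGraph M).Connected := by
  have : Nonempty M.Dart := ⟨e⟩
  exact ⟨fun x y => ((hM.isCyclicLevel_twelve y).exists_walk (by norm_num) x).choose.reachable⟩

/-- Deleting any vertex of the arc-graph increases the total distance by `7460`. -/
theorem IsMooreGraph.wienerIndex_deleteVertex_arcGraph (hM : IsMooreGraph M 4 6) (v : M.Dart) :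
    wienerIndex (deleteVertex (arcGraph M) v) = wienerIndex (arcGraph M) + 7460 := by
  have h := (hM.isCyclicLevel_twelve v).sum_dist_deleteIncidenceSet (by norm_num)
    fun x => ⟨_, hM.isCyclicLevel_twelve x⟩
  -- `h1` sums the distances lost with `v`; `h2` sums the growth over ordered pairs, so `74712 / 2 -
  -- 29896 = 7460`.
  have h1 : ∑ x, min (arcLevel M 5 v x) (2 * 12 - arcLevel M 5 v x) = 29896 :=
    (hM.sum_arcLevel v fun n => min n (2 * 12 - n)).trans (by decide +kernel)
  have h2 : ∑ x, ∑ y, levelGrowth 12 (arcLevel M 5 v x) (arcLevel M 5 v y) = 74712 := by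
    simp only [hM.sum_arcLevel v (levelGrowth 12 _)]
    exact (hM.sum_arcLevel v fun n => ∑ m ∈ Finset.range 24,
      arcLevelCard 4 5 m * levelGrowth 12 n m).trans (by decide +kernel)
  rw [h1, h2, ← two_mul_wienerIndex_deleteVertex, ← two_mul_wienerIndex] at h
  omega

theorem IsMooreGraph.isEdgeDepth_arcDepth (hM : IsMooreGraph M 4 6) (e : M.Dart) :
    IsEdgeDepth (arcGraph M) e e.symm (arcDepth e) where
  left := by
    rw [arcDepth, ((hM.isCyclicLevel_twelve e).eq_zero e).2 rfl, Nat.zero_min]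
  right := by
    have := hM.arcLevel_symm_self (k := 5) (by norm_num) e
    rw [arcDepth]
    omega
  adj x y h := by
    have := (hM.isCyclicLevel_twelve e).adj x y h
    rw [arcDepth, arcDepth]
    omega

theorem IsMooreGraph.eq_symm_of_arcLevel (hM : IsMooreGraph M 4 6) {e a : M.Dart}
    (h : arcLevel M 5 e a + 1 = 24) : a = e.symm := by
  have hs := hM.arcLevel_symm (k := 5) (by norm_num) e a
  have h1 := (hM.isCyclicLevel_twelve e).lt a.symm
  rw [← (hM.arcLevel_eq_zero (k := 5) (by norm_num) e a.symm).1 (by omega), Dart.symm_symm]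

/-- Levels up to `11` descend to `e`; levels from `12` on climb to `23`, where `e.symm` is alone.
`P` lets the walk avoid a deleted vertex. -/
theorem IsMooreGraph.exists_walk_arcDepth (hM : IsMooreGraph M 4 6) (e : M.Dart)
    {K : SimpleGraph M.Dart} {P : M.Dart → Prop}
    (hP : ∀ x y, P x → (arcGraph M).Adj x y → arcDepth e y < arcDepth e x → P y ∧ K.Adj x y)
    {w : M.Dart} (hw : P w) :
    ∃ c, (c = e ∨ c = e.symm) ∧ ∃ q : K.Walk w c, q.length = arcDepth e w := by
  have hg := hM.isCyclicLevel_twelve e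
  have hlt := hg.lt w
  rcases le_or_gt (arcLevel M 5 e w) 11 with h | h
  · obtain ⟨q, hq⟩ := hg.exists_walk_down (K := K) (fun x => P x ∧ arcLevel M 5 e x ≤ 11)
      (fun x y hx _ hadj hy => by
        have := hP x y hx.1 hadj (by rw [arcDepth, arcDepth]; omega)
        exact ⟨⟨this.1, by omega⟩, this.2⟩) w ⟨hw, h⟩
    exact ⟨e, Or.inl rfl, q, by rw [hq, arcDepth]; omega⟩
  · obtain ⟨z, -, hz, q, hq⟩ := hg.exists_walk_up_one (K := K)
      (fun x => P x ∧ 11 < arcLevel M 5 e x)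
      (fun x y hx _ hadj hy => by
        have := hg.lt y
        have := hP x y hx.1 hadj (by rw [arcDepth, arcDepth]; omega)
        exact ⟨⟨this.1, by omega⟩, this.2⟩) w ⟨hw, h⟩ (by omega)
    exact ⟨z, Or.inr (hM.eq_symm_of_arcLevel hz), q, by rw [arcDepth]; omega⟩

theorem IsMooreGraph.card_arcDepth_eq (hM : IsMooreGraph M 4 6) (e : M.Dart) :
    {a : M.Dart | arcDepth e a = 11}.ncard = 1458 := by
  have h : {a : M.Dart | arcDepth e a = 11} =
      ((Finset.univ.filter fun a => arcLevel M 5 e a = 11) ∪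
        Finset.univ.filter fun a => arcLevel M 5 e a = 12 : Finset M.Dart) := by
    ext a
    simp only [Finset.coe_union, Finset.coe_filter, Finset.mem_univ, true_and, Set.mem_union,
      Set.mem_ofPred_eq, arcDepth]
    omega
  rw [h, Set.ncard_coe_finset, Finset.card_union_of_disjoint,
    hM.card_arcLevel_eq (k := 5) (by norm_num) e (by norm_num),
    hM.card_arcLevel_eq (k := 5) (by norm_num) e (by norm_num)]
  · rfl
  · rw [Finset.disjoint_filter]
    omega

/-- Here `6228 = (1 + ⋯ + 111) + 12`. The length of the path and the place of the pendent vertex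
make the value at `m = 11` equal to `7460`. -/
theorem sum_treeDepth (m : ℕ) :
    ∑ t : Fin 111 ⊕ Unit, (m + treeDepth 111 10 t) = 112 * m + 6228 := by
  have h : ∑ t : Fin 111 ⊕ Unit, treeDepth 111 10 t = 6228 := by decide +kernel
  rw [Finset.sum_add_distrib, h]
  simp

theorem IsMooreGraph.isSoltesVertex_inl_iff (hM : IsMooreGraph M 4 6) (e v : M.Dart) :
    IsSoltesVertex (graphQ M e) (.inl v) ↔ arcDepth e v = 11 := by
  have hadj : (arcGraph M).Adj e e.symm := Or.inl rfl
  have hL := hM.isEdgeDepth_arcDepth e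
  have hwalk : ∀ w, ∃ c, (c = e ∨ c = e.symm) ∧
      ∃ q : (arcGraph M).Walk w c, q.length = arcDepth e w := fun w =>
    hM.exists_walk_arcDepth e (P := fun _ => True) (fun _ _ _ h _ => ⟨trivial, h⟩) trivial
  have hW := hM.wienerIndex_deleteVertex_arcGraph v
  have hle := arcDepth_le e v
  constructor
  · rintro ⟨hconn, heq⟩
    have h := le_wienerIndex_deleteVertex_attachTree (n := 111) (p := 10) (by norm_num)
      (by norm_num) hadj hL hwalk hconn
    rw [graphQ] at heq
    rw [sum_treeDepth] at h
    omega
  · intro hv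
    have hv' : ∀ w, w ≠ v → ∃ c, (c = e ∨ c = e.symm) ∧ c ≠ v ∧
        ∃ q : ((arcGraph M).deleteIncidenceSet v).Walk w c, q.length = arcDepth e w := by
      intro w hw
      obtain ⟨c, hc, q⟩ := hM.exists_walk_arcDepth e
        (K := (arcGraph M).deleteIncidenceSet v) (P := fun x => x ≠ v)
        (fun x y hx hxy hlt => by
          -- A descending step ends at depth less than `11`, so it never reaches `v`.
          have hy : y ≠ v := by
            rintro rfl
            have := arcDepth_le e x
            omega
          exact ⟨hy, deleteIncidenceSet_adj.2 ⟨hxy, hx, hy⟩⟩) hw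
      refine ⟨c, hc, ?_, q⟩
      rintro rfl
      have h1 := hL.left
      have h2 := hL.right
      rcases hc with rfl | rfl <;> omega
    have hg := hM.isCyclicLevel_twelve v
    refine ⟨connected_deleteVertex_attachTree (by norm_num) (by norm_num) (fun w hw => ?_)
      (fun x y hx hy => ?_) hadj.ne, ?_⟩
    · obtain ⟨c, hc, hcv, q, -⟩ := hv' w hw
      exact ⟨c, hc, hcv, q.reachable⟩
    · rcases le_total (arcLevel M 5 v x) (arcLevel M 5 v y) with h | h
      · exact (hg.dist_deleteIncidenceSet (by norm_num) (hM.isCyclicLevel_twelve x) hx hy h).1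
      · exact (hg.dist_deleteIncidenceSet (by norm_num) (hM.isCyclicLevel_twelve y)
          hy hx h).1.symm
    · have h := wienerIndex_deleteVertex_attachTree (n := 111) (p := 10) (by norm_num)
        (by norm_num) hadj hL hwalk hv'
      rw [sum_treeDepth] at h
      rw [graphQ]
      omega

theorem IsMooreGraph.connected_graphQ (hM : IsMooreGraph M 4 6) (e : M.Dart) :
    (graphQ M e).Connected :=
  connected_attachTree (by norm_num) (by norm_num) (hM.connected_arcGraph e)

/-- All path vertices but the last are cut vertices; the last one and the pendent vertex are leaves,
whose deletion lowers the total distance. -/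
theorem IsMooreGraph.not_isSoltesVertex_inr (hM : IsMooreGraph M 4 6) (e : M.Dart)
    (t : Fin 111 ⊕ Unit) : ¬ IsSoltesVertex (graphQ M e) (.inr t) := by
  rintro ⟨hconn, heq⟩
  have hQ := hM.connected_graphQ e
  rcases t with i | ⟨⟩
  · rcases Nat.lt_or_ge (i.val + 1) 111 with hi | hi
    · exact not_connected_deleteVertex_attachTree hi hconn
    · have := i.2
      exact (wienerIndex_deleteVertex_attachTree_last hQ (by omega) (by omega)
        (by omega)).ne heq
  · exact (wienerIndex_deleteVertex_attachTree_pendent hQ (by norm_num)).ne heq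

theorem IsMooreGraph.ncard_isSoltesVertex (hM : IsMooreGraph M 4 6) (e : M.Dart) :
    {v | IsSoltesVertex (graphQ M e) v}.ncard = 1458 := by
  have h : {v | IsSoltesVertex (graphQ M e) v} = Sum.inl '' {a | arcDepth e a = 11} := by
    ext (v | t)
    · simp [hM.isSoltesVertex_inl_iff e v]
    · simp [hM.not_isSoltesVertex_inr e t]
  rw [h, Set.ncard_image_of_injective _ Sum.inl_injective, hM.card_arcDepth_eq e]

end Quartic

end Soltes

theorem mainTheorem7 :
    (∃ (M : SimpleGraph (Fin 728)) (_ : DecidableRel M.Adj), Soltes.IsMooreGraph M 4 6) ∧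
    ∀ (V : Type*) [Fintype V] [DecidableEq V] (M : SimpleGraph V) [DecidableRel M.Adj],
      Soltes.IsMooreGraph M 4 6 →
        (Soltes.arcGraph M).IsRegularOfDegree 4 ∧
        Nat.card M.Dart = 2912 ∧
        ∀ e : M.Dart,
          Nat.card (M.Dart ⊕ Fin 111 ⊕ Unit) = 3024 ∧
          {v | Soltes.IsSoltesVertex (Soltes.graphQ M e) v}.ncard = 1458 ∧
          Soltes.IsAlphaSoltes (27 / 56) (Soltes.graphQ M e) := by
  refine ⟨⟨_, inferInstance, Soltes.isMooreGraph_hexagonGraph⟩, ?_⟩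
  intro V _ _ M _ hM
  refine ⟨Soltes.arcGraph_isRegularOfDegree hM.regular, hM.card_dart, fun e => ?_⟩
  have hcard : Nat.card (M.Dart ⊕ Fin 111 ⊕ Unit) = 3024 := by
    have h := hM.card_dart
    rw [Nat.card_eq_fintype_card] at h
    rw [Nat.card_eq_fintype_card, Fintype.card_sum, h]
    rfl
  refine ⟨hcard, hM.ncard_isSoltesVertex e, hM.connected_graphQ e, ?_⟩
  rw [hM.ncard_isSoltesVertex e, hcard]
  norm_num
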